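/- Work in the language of arithmetic $\mathcal{L}_A=\{+,\cdot,\mathrm{S},<,0\}$. A $\Delta_0$-formula is one all of whose quantifiers are bounded, i.e. of the form $\exists x<t$ or $\forall x<t$ with $t$ a term; a $\Sigma_1$-formula is a (possibly empty) block of existential quantifiers followed by a $\Delta_0$-formula; $\mathrm{I}\Sigma_1$ is $\mathrm{PA}^-$ (the theory of non-negative parts of discretely ordered rings) together with induction for $\Sigma_1$-formulae with parameters. A proper cut of a model $\mathcal{M}$ is a nonempty initial segment $I\subsetneq M$ with no last element; it is closed under exponentiation if $2^x\in I$ for all $x\in I$. Put $$\mathrm{SSy}_I(\mathcal{M})=\bigl\{\{i\in I:\mathcal{M}\models i\,E\,c\}:c\in M\bigr\},$$ where $x\,E\,y$ says that the $x$-th bit of the binary expansion of $y$ is $1$. $\mathrm{Th}_{\Sigma_1}(\mathcal{M},i)_{i\in I}$ is the set of $\Sigma_1$-sentences with constants for the elements of $I$ that hold in $\mathcal{M}$. An embedding $j:\mathcal{M}\to\mathcal{N}$ (an isomorphism of $\mathcal{M}$ onto a submodel of $\mathcal{N}$) is a proper initial embedding if its range is an initial segment of $\mathcal{N}$ different from $N$.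 **Theorem.** Let $\mathcal{M}$ and $\mathcal{N}$ be countable nonstandard models of $\mathrm{I}\Sigma_1$, and let $I$ be a proper cut shared by $\mathcal{M}$ and $\mathcal{N}$ (that is, $I$ is a proper cut of both, and both induce the same structure on $I$) that is closed under exponentiation. (A) For all $c\in M$ and $a,b\in N$, the following are equivalent: 1. There is a proper initial embedding $j:\mathcal{M}\to\mathcal{N}$ such that $j(c)=a$, $j(m)<b$ for all $m\in M$, and $j(i)=i$ for all $i\in I$. 2. $\mathrm{SSy}_I(\mathcal{M})=\mathrm{SSy}_I(\mathcal{N})$, and for all $i\in I$ and all $\Delta_0$-formulae $\delta(x,y,z)$, if $\mathcal{M}\models\exists z\,\delta(i,c,z)$, then $\mathcal{N}\models\exists z<b\ \delta(i,a,z)$. (B) The following are equivalent: 1. There is a proper initial embedding $j:\mathcal{M}\to\mathcal{N}$ such that $j(i)=i$ for all $i\in I$. 2. $\mathrm{Th}_{\Sigma_1}(\mathcal{M},i)_{i\in I}\subseteq\mathrm{Th}_{\Sigma_1}(\mathcal{N},i)_{i\in I}$ and $\mathrm{SSy}_I(\mathcal{M})=\mathrm{SSy}_I(\mathcal{N})$.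 -/

import Mathlib

open FirstOrder

namespace ArithModel

/-! ### The language of first order arithmetic and its structures -/

/-- Function symbols of the language of arithmetic: `0`, the successor `S`, `+`, `·`. -/
inductive ArithFunc : ℕ → Type
  | zero : ArithFunc 0
  | succ : ArithFunc 1
  | add : ArithFunc 2
  | mul : ArithFunc 2

/-- Relation symbols of the language of arithmetic: `<`. -/
inductive ArithRel : ℕ → Type
  | lt : ArithRel 2

/-- The language of first order arithmetic `{+, ·, S, <, 0}`. -/
def LA : Language := ⟨ArithFunc, ArithRel⟩

/-- An interpretation of the symbols `0, S, +, ·, <` on a type (no laws are imposed). -/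
class ArithStructure (M : Type*) extends Zero M, Add M, Mul M, LT M where
  /-- the interpretation of `S` -/
  succ : M → M

/-- The first order structure given by the interpretations of the symbols. -/
instance instStructure (M : Type*) [ArithStructure M] : LA.Structure M where
  funMap := fun {_} f =>
    match f with
    | ArithFunc.zero => fun _ => 0
    | ArithFunc.succ => fun v => ArithStructure.succ (v 0)
    | ArithFunc.add => fun v => v 0 + v 1
    | ArithFunc.mul => fun v => v 0 * v 1
  RelMap := fun {_} r =>
    match r with
    | ArithRel.lt => fun v => v 0 < v 1

/-- The element `1 = S 0`. -/
def one (M : Type*) [ArithStructure M] : M := ArithStructure.succ 0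

/-- The standard elements `0, S 0, S S 0, …` of a structure. -/
def numeral (M : Type*) [ArithStructure M] : ℕ → M
  | 0 => 0
  | k + 1 => ArithStructure.succ (numeral M k)

/-- A structure is nonstandard if it has an element other than the standard ones. -/
def IsNonstandard (M : Type*) [ArithStructure M] : Prop :=
  ∃ x : M, ∀ k : ℕ, numeral M k ≠ x

/-! ### Classes of formulae -/

/-- The formula `s < t`. -/
def ltFormula {α : Type*} {n : ℕ} (s t : LA.Term (α ⊕ Fin n)) : LA.BoundedFormula α n :=
  Language.Relations.boundedFormula₂ (L := LA) (ArithRel.lt : LA.Relations 2) s t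

/-- The formula `x < t` where `x` is the next variable to be quantified; `t` does not contain
`x`. -/
def ltBound {α : Type*} {n : ℕ} (t : LA.Term (α ⊕ Fin n)) : LA.BoundedFormula α (n + 1) :=
  ltFormula (Language.Term.var (Sum.inr (Fin.last n)))
    (t.relabel (Sum.map id Fin.castSucc))

/-- `Δ₀`-formulae: all quantifiers are of the form `∀ x < t` or `∃ x < t` for a term `t`.
(All Boolean connectives are abbreviations in terms of `→` and `⊥`.) -/
inductive IsDelta0 {α : Type*} : ∀ {n : ℕ}, LA.BoundedFormula α n → Prop
  | falsum {n : ℕ} : IsDelta0 (Language.BoundedFormula.falsum : LA.BoundedFormula α n)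
  | equal {n : ℕ} (s t : LA.Term (α ⊕ Fin n)) :
      IsDelta0 (Language.BoundedFormula.equal s t)
  | lt {n : ℕ} (s t : LA.Term (α ⊕ Fin n)) : IsDelta0 (ltFormula s t)
  | imp {n : ℕ} {φ ψ : LA.BoundedFormula α n} (hφ : IsDelta0 φ) (hψ : IsDelta0 ψ) :
      IsDelta0 (φ.imp ψ)
  | ball {n : ℕ} (t : LA.Term (α ⊕ Fin n)) {φ : LA.BoundedFormula α (n + 1)}
      (hφ : IsDelta0 φ) : IsDelta0 ((ltBound t).imp φ).all
  | bex {n : ℕ} (t : LA.Term (α ⊕ Fin n)) {φ : LA.BoundedFormula α (n + 1)}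
      (hφ : IsDelta0 φ) : IsDelta0 (ltBound t ⊓ φ).ex

/-- `Σ₁`-formulae: a (possibly empty) block of existential quantifiers followed by a
`Δ₀`-formula. -/
inductive IsSigma1 {α : Type*} : ∀ {n : ℕ}, LA.BoundedFormula α n → Prop
  | of_delta0 {n : ℕ} {φ : LA.BoundedFormula α n} (hφ : IsDelta0 φ) : IsSigma1 φ
  | ex {n : ℕ} {φ : LA.BoundedFormula α (n + 1)} (hφ : IsSigma1 φ) : IsSigma1 φ.ex

/-! ### Theories -/

/-- `M ⊨ PA⁻`: `M` is the non-negative part of a discretely ordered ring. -/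
structure ModelsPAMinus (M : Type*) [ArithStructure M] : Prop where
  succ_eq : ∀ x : M, ArithStructure.succ x = x + one M
  add_assoc : ∀ x y z : M, (x + y) + z = x + (y + z)
  add_comm : ∀ x y : M, x + y = y + x
  mul_assoc : ∀ x y z : M, (x * y) * z = x * (y * z)
  mul_comm : ∀ x y : M, x * y = y * x
  mul_add : ∀ x y z : M, x * (y + z) = x * y + x * z
  add_zero : ∀ x : M, x + 0 = x
  mul_zero : ∀ x : M, x * 0 = 0
  mul_one : ∀ x : M, x * one M = x
  lt_trans : ∀ x y z : M, x < y → y < z → x < z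
  lt_irrefl : ∀ x : M, ¬ x < x
  lt_total : ∀ x y : M, x < y ∨ x = y ∨ y < x
  add_lt_add : ∀ x y z : M, x < y → x + z < y + z
  mul_lt_mul : ∀ x y z : M, 0 < z → x < y → x * z < y * z
  exists_add_of_lt : ∀ x y : M, x < y → ∃ z : M, x + z = y
  zero_lt_one : (0 : M) < one M
  one_le_of_pos : ∀ x : M, 0 < x → one M = x ∨ one M < x
  zero_le : ∀ x : M, 0 = x ∨ 0 < x

/-- `M ⊨ IΣ₁`: `M ⊨ PA⁻`, and induction holds for every `Σ₁`-formula `φ(x, v)` with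
parameters `v` from `M`. -/
structure ModelsISigma1 (M : Type*) [ArithStructure M] : Prop extends ModelsPAMinus M where
  induction : ∀ (n : ℕ) (φ : LA.Formula (Fin (n + 1))), IsSigma1 φ → ∀ v : Fin n → M,
    φ.Realize (Fin.cons 0 v : Fin (n + 1) → M) →
    (∀ x : M, φ.Realize (Fin.cons x v : Fin (n + 1) → M) →
      φ.Realize (Fin.cons (ArithStructure.succ x) v : Fin (n + 1) → M)) →
    ∀ x : M, φ.Realize (Fin.cons x v : Fin (n + 1) → M)

/-! ### Exponentiation and Ackermann membership -/

section Exponentiation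

variable {M : Type*} [ArithStructure M]

/-- Gödel's `β`-predicate: `v` is the remainder of `s` on division by `1 + (i + 1) · t`. -/
def Beta (s t i v : M) : Prop :=
  v < one M + (i + one M) * t ∧ ∃ q : M, s = q * (one M + (i + one M) * t) + v

/-- `M ⊨ y = 2 ^ x`: there is a `β`-coded sequence of length `x + 1` that starts with `1`, is
doubled at each step, and ends in `y`. In models of `IΣ₁` this is the graph of a total function,
the one given by the recursion `2 ^ 0 = 1`, `2 ^ (x + 1) = 2 · 2 ^ x`. -/
def Exp (x y : M) : Prop :=
  ∃ s t : M, Beta s t 0 (one M) ∧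
    (∀ i : M, i < x → ∃ v : M, Beta s t i v ∧ Beta s t (i + one M) (v + v)) ∧
    Beta s t x y

/-- Ackermann's membership relation `x E y`: the `x`-th bit of the binary expansion of `y`
is `1`, that is, `y = (2 q + 1) · 2 ^ x + r` with `r < 2 ^ x`. -/
def AckMem (x y : M) : Prop :=
  ∃ p : M, Exp x p ∧ ∃ q r : M, r < p ∧ y = (q + q + one M) * p + r

end Exponentiation

/-! ### Cuts and initial embeddings -/

section Cuts

variable {M : Type*} [ArithStructure M]

/-- `I` is an initial segment of `M`. -/
def IsInitialSegment (I : Set M) : Prop := ∀ x ∈ I, ∀ y : M, y < x → y ∈ I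

/-- A proper cut: a (nonempty) initial segment with no last element, other than the whole
model. -/
structure IsProperCut (I : Set M) : Prop where
  nonempty : I.Nonempty
  initial : IsInitialSegment I
  no_last : ∀ x ∈ I, ∃ y ∈ I, x < y
  proper : I ≠ Set.univ

/-- `I` is closed under exponentiation `x ↦ 2 ^ x`. -/
def ClosedUnderExp (I : Set M) : Prop := ∀ x ∈ I, ∃ y ∈ I, Exp x y

end Cuts

/-- The embedding `e` identifies the structure `I` with a proper cut of `M` that is closed under
exponentiation. -/
structure IsProperExpCut {I M : Type*} [ArithStructure I] [ArithStructure M]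
    (e : I ↪[LA] M) : Prop where
  isProperCut : IsProperCut (Set.range e)
  closedUnderExp : ClosedUnderExp (Set.range e)

/-- `SSy_I(M)`: the family of all sets `I ∩ {x ∈ M : M ⊨ x E c}`, for `c ∈ M`. Here `I` is viewed
inside `M` through the embedding `e`. -/
def SSy {I M : Type*} [ArithStructure I] [ArithStructure M] (e : I ↪[LA] M) : Set (Set I) :=
  {S | ∃ c : M, S = {i : I | AckMem (e i) c}}

/-- `Th_{Σ₁}(M, i)_{i ∈ I}`: the `Σ₁`-sentences with constants for the elements of `I` that are
true in `M`. A sentence with constants from `I` is given as a formula whose free variables are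
elements of `I`, each interpreted as its image under `e`. -/
def ThSigma1 {I M : Type*} [ArithStructure I] [ArithStructure M] (e : I ↪[LA] M) :
    Set (LA.Formula I) :=
  {φ | IsSigma1 φ ∧ φ.Realize (e : I → M)}

/-- A proper initial embedding: its range is an initial segment, and it is not surjective. -/
structure IsProperInitial {M N : Type*} [ArithStructure M] [ArithStructure N]
    (j : M ↪[LA] N) : Prop where
  initial : IsInitialSegment (Set.range j)
  proper : ¬ Function.Surjective j

end ArithModel

open ArithModel

open ArithModel

namespace ArithModel

/-! ### Positive formulas with de Bruijn variables -/

/-! This is a Friedman-style back-and-forth between countable models. It runs on a Σ₁ truth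
predicate for "game formulas" whose codes lie in the cut `I`. A code is either an atom `x·y + z = w
+ i` with `i` in the cut, or `∃ x ⋀ h`, or `∀ x < y ⋁ h`, where `h` codes a set of codes. Since `I`
may be nonstandard, these conjunctions and disjunctions need not be finite in the real sense. A code
`u` is true at an assignment `c` if some coded set `W` contains `(u, c)` and every pair in `W` is
justified by others in `W`. All unbounded quantifiers can be restricted to a set `D`. In `M` one
takes `D = univ`, where the truth clauses can be introduced (`phiD_of_clause`); in `N` one takes `D
= below b`, where only their elimination is needed (`PhiD.clause`).

The invariant `Transfers` says that codes from the cut true in `M` are true in `N` below `b`.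
Condition 2, applied to the single formula `Fm.psi`, starts it. For the forth step, the codes true
of a new element `m` form a coded set by Σ₁-comprehension, and by equality of the `SSy` its trace on
`I` is coded in `N`. Truncations of the set lie in `I` because `I` is closed under exponentiation,
so `∃ x ⋀` transfers each truncation, and overspill in `N` gives one `x` that works for all of `I`.
The back step is dual, with `∀ x < y ⋁`, the set of codes false in `N`, and overspill in `M`; it
makes the range an initial segment. The atoms make the limit map an embedding that fixes `I` and
stays below `b`. This is `exists_properInitial`.

In (A), reflection (`Fm.eval_univ_iff`) turns `Fm.psi` into a Δ₀-formula with a bound variable. In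
(B), collection in `N` supplies a suitable `b`. The converse directions hold because Δ₀-formulas and
binary digits are absolute for initial embeddings. -/

/-- Prepend an element to an environment. -/
def scons {X : Type*} (a : X) (ρ : ℕ → X) : ℕ → X
  | 0 => a
  | k + 1 => ρ k

@[simp] theorem scons_zero {X : Type*} (a : X) (ρ : ℕ → X) : scons a ρ 0 = a := rfl
@[simp] theorem scons_succ {X : Type*} (a : X) (ρ : ℕ → X) (k : ℕ) :
    scons a ρ (k + 1) = ρ k := rfl

/-- Terms of arithmetic with de Bruijn variables and constants from `C`. -/
inductive Tm (C : Type*) where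
  | var (k : ℕ) : Tm C
  | const (c : C) : Tm C
  | zero : Tm C
  | one : Tm C
  | add (s t : Tm C) : Tm C
  | mul (s t : Tm C) : Tm C

/-- Negation free formulas with bounded quantifiers and unbounded existential quantifiers. -/
inductive Fm (C : Type*) where
  | eq (s t : Tm C) : Fm C
  | lt (s t : Tm C) : Fm C
  | and (f g : Fm C) : Fm C
  | or (f g : Fm C) : Fm C
  | ball (t : Tm C) (f : Fm C) : Fm C
  | bex (t : Tm C) (f : Fm C) : Fm C
  | ex (f : Fm C) : Fm C

section Semantics

variable {C : Type*} {K : Type*} [ArithStructure K]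

/-- The value of a term. -/
def Tm.eval (κ : C → K) (ρ : ℕ → K) : Tm C → K
  | var k => ρ k
  | const c => κ c
  | zero => 0
  | one => ArithModel.one K
  | add s t => s.eval κ ρ + t.eval κ ρ
  | mul s t => s.eval κ ρ * t.eval κ ρ

/-- The truth value of a formula, unbounded quantifiers ranging over `D`. -/
def Fm.eval (D : Set K) (κ : C → K) : Fm C → (ℕ → K) → Prop
  | eq s t, ρ => s.eval κ ρ = t.eval κ ρ
  | lt s t, ρ => s.eval κ ρ < t.eval κ ρ
  | and f g, ρ => f.eval D κ ρ ∧ g.eval D κ ρ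
  | or f g, ρ => f.eval D κ ρ ∨ g.eval D κ ρ
  | ball t f, ρ => ∀ a, a < t.eval κ ρ → f.eval D κ (scons a ρ)
  | bex t f, ρ => ∃ a, a < t.eval κ ρ ∧ f.eval D κ (scons a ρ)
  | ex f, ρ => ∃ a, a ∈ D ∧ f.eval D κ (scons a ρ)

/-- The set of elements below `b`. -/
def below (b : K) : Set K := {x | x < b}

@[simp] theorem mem_below {b x : K} : x ∈ below b ↔ x < b := Iff.rfl

/-- This is why `Fm` has no negation, and no universal quantifier over `D`. -/
theorem Fm.eval_mono {D D' : Set K} (h : D ⊆ D') {κ : C → K} {f : Fm C} :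
    ∀ {ρ : ℕ → K}, f.eval D κ ρ → f.eval D' κ ρ := by
  induction f with
  | eq => exact id
  | lt => exact id
  | and f g hf hg => exact fun H => ⟨hf H.1, hg H.2⟩
  | or f g hf hg => exact fun H => H.imp hf hg
  | ball t f hf => exact fun H a ha => hf (H a ha)
  | bex t f hf => exact fun ⟨a, ha, H⟩ => ⟨a, ha, hf H⟩
  | ex f hf => exact fun ⟨a, ha, H⟩ => ⟨a, h ha, hf H⟩

end Semantics

/-! ### Translation into first order formulas -/

/-- Weakening of a term of the language of arithmetic. -/
def liftTerm {α : Type*} {n : ℕ} (t : LA.Term (α ⊕ Fin n)) : LA.Term (α ⊕ Fin (n + 1)) :=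
  t.relabel (Sum.map id Fin.castSucc)

/-- The term `S 0`. -/
def oneTerm {β : Type*} : LA.Term β :=
  Language.Term.func (ArithFunc.succ : LA.Functions 1)
    ![Language.Term.func (ArithFunc.zero : LA.Functions 0) ![] ]

/-- The term `0`. -/
def zeroTerm {β : Type*} : LA.Term β :=
  Language.Term.func (ArithFunc.zero : LA.Functions 0) ![]

/-- Translation of terms. -/
def Tm.tr {C β : Type*} (κ : C → LA.Term β) (σ : ℕ → LA.Term β) : Tm C → LA.Term β
  | var k => σ k
  | const c => κ c
  | zero => zeroTerm
  | one => oneTerm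
  | add s t => Language.Term.func (ArithFunc.add : LA.Functions 2) ![s.tr κ σ, t.tr κ σ]
  | mul s t => Language.Term.func (ArithFunc.mul : LA.Functions 2) ![s.tr κ σ, t.tr κ σ]

/-- The variable quantified last. -/
def lastVar {α : Type*} {n : ℕ} : LA.Term (α ⊕ Fin (n + 1)) :=
  Language.Term.var (Sum.inr (Fin.last n))

/-- Translation into `Δ₀`-formulas, the unbounded quantifiers being bounded by `b`. -/
def Fm.tr {C α : Type*} : Fm C → ∀ {n : ℕ} (_ : LA.Term (α ⊕ Fin n))
    (_ : C → LA.Term (α ⊕ Fin n)) (_ : ℕ → LA.Term (α ⊕ Fin n)), LA.BoundedFormula α n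
  | eq s t, _, _, κ, σ => Language.BoundedFormula.equal (s.tr κ σ) (t.tr κ σ)
  | lt s t, _, _, κ, σ => ltFormula (s.tr κ σ) (t.tr κ σ)
  | and f g, _, b, κ, σ => f.tr b κ σ ⊓ g.tr b κ σ
  | or f g, _, b, κ, σ => f.tr b κ σ ⊔ g.tr b κ σ
  | ball t f, _, b, κ, σ => ((ltBound (t.tr κ σ)).imp
      (f.tr (liftTerm b) (liftTerm ∘ κ) (scons lastVar (liftTerm ∘ σ)))).all
  | bex t f, _, b, κ, σ => (ltBound (t.tr κ σ) ⊓
      (f.tr (liftTerm b) (liftTerm ∘ κ) (scons lastVar (liftTerm ∘ σ)))).ex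
  | ex f, _, b, κ, σ => (ltBound b ⊓
      (f.tr (liftTerm b) (liftTerm ∘ κ) (scons lastVar (liftTerm ∘ σ)))).ex

theorem IsDelta0.not {α : Type*} {n : ℕ} {φ : LA.BoundedFormula α n} (h : IsDelta0 φ) :
    IsDelta0 φ.not := h.imp .falsum

theorem Fm.isDelta0_tr {C α : Type*} (f : Fm C) : ∀ {n : ℕ} (b : LA.Term (α ⊕ Fin n))
    (κ : C → LA.Term (α ⊕ Fin n)) (σ : ℕ → LA.Term (α ⊕ Fin n)), IsDelta0 (f.tr b κ σ) := by
  induction f with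
  | eq s t => exact fun _ _ _ => .equal _ _
  | lt s t => exact fun _ _ _ => .lt _ _
  | and f g hf hg => exact fun _ _ _ => ((hf _ _ _).imp (hg _ _ _).not).not
  | or f g hf hg => exact fun _ _ _ => (hf _ _ _).not.imp (hg _ _ _)
  | ball t f hf => exact fun _ _ _ => .ball _ (hf _ _ _)
  | bex t f hf => exact fun _ _ _ => .bex _ (hf _ _ _)
  | ex f hf => exact fun _ _ _ => .bex _ (hf _ _ _)

section Realize

variable {K : Type*} [ArithStructure K]

@[simp] theorem realize_liftTerm {α : Type*} {n : ℕ} (t : LA.Term (α ⊕ Fin n)) (v : α → K)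
    (xs : Fin n → K) (a : K) :
    (liftTerm t).realize (Sum.elim v (Fin.snoc xs a : Fin (n + 1) → K)) =
      t.realize (Sum.elim v xs) := by
  rw [liftTerm, Language.Term.realize_relabel]
  congr 1
  funext i
  cases i <;> simp

@[simp] theorem realize_lastVar {α : Type*} {n : ℕ} (v : α → K) (xs : Fin n → K) (a : K) :
    (lastVar : LA.Term (α ⊕ Fin (n + 1))).realize
      (Sum.elim v (Fin.snoc xs a : Fin (n + 1) → K)) = a := by
  simp [lastVar]

theorem realize_ltFormula {α : Type*} {n : ℕ} (s t : LA.Term (α ⊕ Fin n)) (v : α → K)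
    (xs : Fin n → K) : (ltFormula s t).Realize v xs ↔
      s.realize (Sum.elim v xs) < t.realize (Sum.elim v xs) := by
  unfold ltFormula
  exact Language.BoundedFormula.realize_rel₂

theorem realize_ltBound {α : Type*} {n : ℕ} (t : LA.Term (α ⊕ Fin n)) (v : α → K)
    (xs : Fin n → K) (a : K) :
    (ltBound t).Realize v (Fin.snoc xs a : Fin (n + 1) → K) ↔
      a < t.realize (Sum.elim v xs) := by
  have h := realize_liftTerm t v xs a
  have h' := realize_lastVar v xs a
  rw [liftTerm] at h
  rw [lastVar] at h'
  rw [ltBound, realize_ltFormula, h, h']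

@[simp] theorem realize_zeroTerm {β : Type*} (v : β → K) :
    (zeroTerm : LA.Term β).realize v = 0 := rfl

theorem Tm.realize_tr {C β : Type*} (κ : C → LA.Term β) (σ : ℕ → LA.Term β) (t : Tm C)
    (v : β → K) : (t.tr κ σ).realize v =
      t.eval (fun c => (κ c).realize v) (fun k => (σ k).realize v) := by
  induction t with
  | var => rfl
  | const => rfl
  | zero => rfl
  | one => rfl
  | add s t hs ht => rw [Tm.eval, ← hs, ← ht]; rfl
  | mul s t hs ht => rw [Tm.eval, ← hs, ← ht]; rfl

theorem realize_scons_lastVar {α : Type*} {n : ℕ} (σ : ℕ → LA.Term (α ⊕ Fin n)) (v : α → K)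
    (xs : Fin n → K) (a : K) :
    (fun k => (scons lastVar (liftTerm ∘ σ) k).realize
      (Sum.elim v (Fin.snoc xs a : Fin (n + 1) → K))) =
      scons a (fun k => (σ k).realize (Sum.elim v xs)) := by
  funext k
  cases k <;> simp

theorem Fm.realize_tr {C α : Type*} (f : Fm C) : ∀ {n : ℕ} (b : LA.Term (α ⊕ Fin n))
    (κ : C → LA.Term (α ⊕ Fin n)) (σ : ℕ → LA.Term (α ⊕ Fin n)) (v : α → K) (xs : Fin n → K),
    (f.tr b κ σ).Realize v xs ↔ f.eval (below (b.realize (Sum.elim v xs)))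
      (fun c => (κ c).realize (Sum.elim v xs)) (fun k => (σ k).realize (Sum.elim v xs)) := by
  induction f with
  | eq s t =>
    intro n b κ σ v xs
    simp only [Fm.eval, ← Tm.realize_tr]; rfl
  | lt s t =>
    intro n b κ σ v xs
    simp only [Fm.eval, ← Tm.realize_tr, Fm.tr, realize_ltFormula]
  | and f g hf hg =>
    intro n b κ σ v xs
    simp only [Fm.eval, Fm.tr, Language.BoundedFormula.realize_inf, hf, hg]
  | or f g hf hg =>
    intro n b κ σ v xs
    simp only [Fm.eval, Fm.tr, Language.BoundedFormula.realize_sup, hf, hg]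
  | ball t f hf =>
    intro n b κ σ v xs
    simp only [Fm.eval, Fm.tr, Language.BoundedFormula.realize_all,
      Language.BoundedFormula.realize_imp, realize_ltBound, Tm.realize_tr, hf,
      realize_liftTerm, realize_scons_lastVar, Function.comp_apply]
  | bex t f hf =>
    intro n b κ σ v xs
    simp only [Fm.eval, Fm.tr, Language.BoundedFormula.realize_ex,
      Language.BoundedFormula.realize_inf, realize_ltBound, Tm.realize_tr, hf,
      realize_liftTerm, realize_scons_lastVar, Function.comp_apply]
  | ex f hf =>
    intro n b κ σ v xs
    simp only [Fm.eval, Fm.tr, Language.BoundedFormula.realize_ex, mem_below,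
      Language.BoundedFormula.realize_inf, realize_ltBound, hf,
      realize_liftTerm, realize_scons_lastVar, Function.comp_apply]

end Realize

/-! ### Substitution -/

/-- Simultaneous substitution for the constants and the variables of a term. -/
def Tm.subst {C C' : Type*} (κ : C → Tm C') (σ : ℕ → Tm C') : Tm C → Tm C'
  | var k => σ k
  | const c => κ c
  | zero => zero
  | one => one
  | add s t => add (s.subst κ σ) (t.subst κ σ)
  | mul s t => mul (s.subst κ σ) (t.subst κ σ)

/-- Weakening of a term. -/
def Tm.lift {C : Type*} : Tm C → Tm C := Tm.subst const fun k => var (k + 1)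

/-- Simultaneous substitution for the constants and the variables of a formula. -/
def Fm.subst {C C' : Type*} : Fm C → (C → Tm C') → (ℕ → Tm C') → Fm C'
  | eq s t, κ, σ => eq (s.subst κ σ) (t.subst κ σ)
  | lt s t, κ, σ => lt (s.subst κ σ) (t.subst κ σ)
  | and f g, κ, σ => and (f.subst κ σ) (g.subst κ σ)
  | or f g, κ, σ => or (f.subst κ σ) (g.subst κ σ)
  | ball t f, κ, σ =>
    ball (t.subst κ σ) (f.subst (Tm.lift ∘ κ) (scons (Tm.var 0) (Tm.lift ∘ σ)))
  | bex t f, κ, σ => bex (t.subst κ σ) (f.subst (Tm.lift ∘ κ) (scons (Tm.var 0) (Tm.lift ∘ σ)))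
  | ex f, κ, σ => ex (f.subst (Tm.lift ∘ κ) (scons (Tm.var 0) (Tm.lift ∘ σ)))

section Subst

variable {C C' K : Type*} [ArithStructure K]

theorem Tm.eval_subst (κ' : C' → K) (κ : C → Tm C') (σ : ℕ → Tm C') (ρ : ℕ → K) (t : Tm C) :
    (t.subst κ σ).eval κ' ρ =
      t.eval (fun c => (κ c).eval κ' ρ) (fun k => (σ k).eval κ' ρ) := by
  induction t with
  | add s t hs ht => simp only [Tm.subst, Tm.eval, hs, ht]
  | mul s t hs ht => simp only [Tm.subst, Tm.eval, hs, ht]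
  | _ => rfl

@[simp] theorem Tm.eval_lift (κ : C → K) (ρ : ℕ → K) (a : K) (t : Tm C) :
    t.lift.eval κ (scons a ρ) = t.eval κ ρ := by
  rw [Tm.lift, Tm.eval_subst]
  rfl

theorem eval_scons_lift (κ : C → K) (σ : ℕ → Tm C) (ρ : ℕ → K) (a : K) :
    (fun k => (scons (Tm.var 0) (Tm.lift ∘ σ) k).eval κ (scons a ρ)) =
      scons a (fun k => (σ k).eval κ ρ) := by
  funext k
  cases k
  · rfl
  · simp

theorem Fm.eval_subst (D : Set K) (κ' : C' → K) (f : Fm C) :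
    ∀ (κ : C → Tm C') (σ : ℕ → Tm C') (ρ : ℕ → K), (f.subst κ σ).eval D κ' ρ ↔
      f.eval D (fun c => (κ c).eval κ' ρ) (fun k => (σ k).eval κ' ρ) := by
  induction f with
  | eq s t => intro κ σ ρ; simp only [Fm.subst, Fm.eval, Tm.eval_subst]
  | lt s t => intro κ σ ρ; simp only [Fm.subst, Fm.eval, Tm.eval_subst]
  | and f g hf hg => intro κ σ ρ; simp only [Fm.subst, Fm.eval, hf, hg]
  | or f g hf hg => intro κ σ ρ; simp only [Fm.subst, Fm.eval, hf, hg]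
  | ball t f hf =>
    intro κ σ ρ
    simp only [Fm.subst, Fm.eval, Tm.eval_subst, hf, eval_scons_lift, Function.comp_apply,
      Tm.eval_lift]
  | bex t f hf =>
    intro κ σ ρ
    simp only [Fm.subst, Fm.eval, Tm.eval_subst, hf, eval_scons_lift, Function.comp_apply,
      Tm.eval_lift]
  | ex f hf =>
    intro κ σ ρ
    simp only [Fm.subst, Fm.eval, hf, eval_scons_lift, Function.comp_apply,
      Tm.eval_lift]

end Subst

/-! ### Finitely many parameters -/

/-- The list of constants of a term. -/
def Tm.consts {C : Type*} : Tm C → List C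
  | const c => [c]
  | add s t => s.consts ++ t.consts
  | mul s t => s.consts ++ t.consts
  | _ => []

/-- The list of constants of a formula. -/
def Fm.consts {C : Type*} : Fm C → List C
  | eq s t => s.consts ++ t.consts
  | lt s t => s.consts ++ t.consts
  | and f g => f.consts ++ g.consts
  | or f g => f.consts ++ g.consts
  | ball t f => t.consts ++ f.consts
  | bex t f => t.consts ++ f.consts
  | ex f => f.consts

theorem Tm.eval_congr {C K : Type*} [ArithStructure K] {κ κ' : C → K} (ρ : ℕ → K) (t : Tm C)
    (h : ∀ c ∈ t.consts, κ c = κ' c) : t.eval κ ρ = t.eval κ' ρ := by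
  induction t with
  | const c => exact h c (by simp [Tm.consts])
  | add s t hs ht =>
    simp only [Tm.eval, Tm.consts, List.mem_append] at *
    rw [hs fun c hc => h c (.inl hc), ht fun c hc => h c (.inr hc)]
  | mul s t hs ht =>
    simp only [Tm.eval, Tm.consts, List.mem_append] at *
    rw [hs fun c hc => h c (.inl hc), ht fun c hc => h c (.inr hc)]
  | _ => rfl

theorem Fm.eval_congr {C K : Type*} [ArithStructure K] {D : Set K} {κ κ' : C → K} (f : Fm C) :
    ∀ (ρ : ℕ → K), (∀ c ∈ f.consts, κ c = κ' c) → (f.eval D κ ρ ↔ f.eval D κ' ρ) := by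
  induction f with
  | eq s t =>
    intro ρ h
    simp only [Fm.consts, List.mem_append] at h
    rw [Fm.eval, Fm.eval, s.eval_congr ρ fun c hc => h c (.inl hc),
      t.eval_congr ρ fun c hc => h c (.inr hc)]
  | lt s t =>
    intro ρ h
    simp only [Fm.consts, List.mem_append] at h
    rw [Fm.eval, Fm.eval, s.eval_congr ρ fun c hc => h c (.inl hc),
      t.eval_congr ρ fun c hc => h c (.inr hc)]
  | and f g hf hg =>
    intro ρ h
    simp only [Fm.consts, List.mem_append] at h
    rw [Fm.eval, Fm.eval, hf ρ fun c hc => h c (.inl hc), hg ρ fun c hc => h c (.inr hc)]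
  | or f g hf hg =>
    intro ρ h
    simp only [Fm.consts, List.mem_append] at h
    rw [Fm.eval, Fm.eval, hf ρ fun c hc => h c (.inl hc), hg ρ fun c hc => h c (.inr hc)]
  | ball t f hf =>
    intro ρ h
    simp only [Fm.consts, List.mem_append] at h
    simp only [Fm.eval, t.eval_congr ρ fun c hc => h c (.inl hc),
      fun a => hf (scons a ρ) fun c hc => h c (.inr hc)]
  | bex t f hf =>
    intro ρ h
    simp only [Fm.consts, List.mem_append] at h
    simp only [Fm.eval, t.eval_congr ρ fun c hc => h c (.inl hc),
      fun a => hf (scons a ρ) fun c hc => h c (.inr hc)]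
  | ex f hf =>
    intro ρ h
    simp only [Fm.consts] at h
    simp only [Fm.eval, fun a => hf (scons a ρ) h]

/-- Induction for `∃ z, f(z, x)`, where `f` may contain parameters and its unbounded quantifiers
are bounded by `z`. -/
theorem ModelsISigma1.induction_eval {K : Type*} [ArithStructure K] (hK : ModelsISigma1 K)
    (f : Fm K) (h0 : ∃ z, f.eval (below z) id (scons 0 fun _ => 0))
    (hs : ∀ x : K, (∃ z, f.eval (below z) id (scons x fun _ => 0)) →
      ∃ z, f.eval (below z) id (scons (ArithStructure.succ x) fun _ => 0)) (x : K) :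
    ∃ z, f.eval (below z) id (scons x fun _ => 0) := by
  classical
  let l := f.consts
  -- The constants of `f` become the parameters of the induction axiom, looked up by their position
  -- in `l`. The bound on the remaining quantifiers is the one leading existential quantifier, so
  -- `φ` is Σ₁. The default `zeroTerm` is never reached for constants of `f`.
  let φ : LA.Formula (Fin (l.length + 1)) :=
    Language.BoundedFormula.ex (f.tr (n := 1) lastVar
      (fun c => if h : l.idxOf c < l.length then
        Language.Term.var (Sum.inl (Fin.succ ⟨l.idxOf c, h⟩)) else zeroTerm)
      (scons (Language.Term.var (Sum.inl 0)) fun _ => zeroTerm))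
  have key : ∀ x : K, φ.Realize (Fin.cons x l.get : Fin (l.length + 1) → K) ↔
      ∃ z, f.eval (below z) id (scons x fun _ => 0) := by
    intro x
    show Language.BoundedFormula.Realize _ _ _ ↔ _
    simp only [φ, Language.BoundedFormula.realize_ex]
    refine exists_congr fun z => ?_
    rw [Fm.realize_tr, realize_lastVar]
    refine Iff.trans (f.eval_congr (κ' := id) _ ?_) (Eq.to_iff ?_)
    · intro c hc
      have h : l.idxOf c < l.length := List.idxOf_lt_length_iff.2 hc
      have hx : (Fin.cons x l.get : Fin (l.length + 1) → K) (Fin.succ ⟨l.idxOf c, h⟩) = c := by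
        rw [Fin.cons_succ]
        exact List.idxOf_get h
      simp only [h, dif_pos, Language.Term.realize_var, Sum.elim_inl, hx, id]
    · congr 1
      funext k
      cases k <;> simp
  have := hK.induction l.length φ (.ex (.of_delta0 (Fm.isDelta0_tr _ _ _ _))) l.get
  simp only [key] at this
  exact this h0 hs x

/-! ### Models of `IΣ₁` as ordered semirings -/

section Algebra

variable {K : Type*} [ArithStructure K] [hK : Fact (ModelsISigma1 K)]

/-- The semiring structure of a model of `IΣ₁`. -/
instance instCommSemiring : CommSemiring K where
  one := one K
  add_assoc := hK.out.add_assoc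
  add_comm := hK.out.add_comm
  zero_add x := (hK.out.add_comm 0 x).trans (hK.out.add_zero x)
  add_zero := hK.out.add_zero
  mul_assoc := hK.out.mul_assoc
  mul_comm := hK.out.mul_comm
  left_distrib := hK.out.mul_add
  right_distrib x y z := by
    rw [hK.out.mul_comm, hK.out.mul_add, hK.out.mul_comm z x, hK.out.mul_comm z y]
  zero_mul x := (hK.out.mul_comm 0 x).trans (hK.out.mul_zero x)
  mul_zero := hK.out.mul_zero
  one_mul x := (hK.out.mul_comm (one K) x).trans (hK.out.mul_one x)
  mul_one := hK.out.mul_one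
  nsmul := nsmulRec

open scoped Classical in
/-- The linear order of a model of `IΣ₁`. -/
noncomputable instance instLinearOrder : LinearOrder K where
  le x y := x < y ∨ x = y
  lt := (· < ·)
  le_refl x := .inr rfl
  le_trans x y z h h' := by
    rcases h with h | rfl
    · rcases h' with h' | rfl
      · exact .inl (hK.out.lt_trans _ _ _ h h')
      · exact .inl h
    · exact h'
  lt_iff_le_not_ge x y := by
    refine ⟨fun h => ⟨.inl h, ?_⟩, ?_⟩
    · rintro (h' | rfl)
      · exact hK.out.lt_irrefl _ (hK.out.lt_trans _ _ _ h h')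
      · exact hK.out.lt_irrefl _ h
    · rintro ⟨h | rfl, h'⟩
      · exact h
      · exact absurd (.inr rfl) h'
  le_antisymm x y h h' := by
    rcases h with h | rfl
    · rcases h' with h' | rfl
      · exact absurd (hK.out.lt_trans _ _ _ h h') (hK.out.lt_irrefl _)
      · rfl
    · rfl
  le_total x y := by
    rcases hK.out.lt_total x y with h | h | h
    · exact .inl (.inl h)
    · exact .inl (.inr h)
    · exact .inr (.inl h)
  toDecidableLE := Classical.decRel _

theorem one_eq : one K = 1 := rfl

theorem succ_eq (x : K) : ArithStructure.succ x = x + 1 := hK.out.succ_eq x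

instance : IsOrderedAddMonoid K where
  add_le_add_left x y h z := by
    rcases h with h | rfl
    · exact .inl (hK.out.add_lt_add x y z h)
    · exact le_rfl

instance : IsOrderedCancelAddMonoid K where
  le_of_add_le_add_left x y z h := by
    by_contra! h'
    have := hK.out.add_lt_add z y x h'
    rw [add_comm, add_comm y] at this
    exact absurd h (not_le.2 this)

instance : ZeroLEOneClass K := ⟨.inl hK.out.zero_lt_one⟩

instance : Nontrivial K := ⟨0, 1, hK.out.zero_lt_one.ne⟩

instance : IsStrictOrderedRing K where
  mul_lt_mul_of_pos_left z hz x y h := by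
    have := hK.out.mul_lt_mul x y z hz h
    rwa [mul_comm, mul_comm y] at this
  mul_lt_mul_of_pos_right z hz x y h := hK.out.mul_lt_mul x y z hz h

instance : CanonicallyOrderedAdd K where
  exists_add_of_le {x y} h := by
    rcases h with h | rfl
    · obtain ⟨z, hz⟩ := hK.out.exists_add_of_lt x y h
      exact ⟨z, hz.symm⟩
    · exact ⟨0, (add_zero x).symm⟩
  le_add_self x y := by
    rcases hK.out.zero_le y with rfl | h
    · exact (zero_add x).ge
    · have := hK.out.add_lt_add 0 y x h
      rw [zero_add] at this
      exact this.le
  le_self_add x y := by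
    rcases hK.out.zero_le y with rfl | h
    · exact (add_zero x).ge
    · have := hK.out.add_lt_add 0 y x h
      rw [zero_add, add_comm] at this
      exact this.le

theorem lt_add_one_iff' {x y : K} : x < y + 1 ↔ x ≤ y := by
  refine ⟨fun h => ?_, fun h => h.trans_lt (lt_add_one y)⟩
  by_contra! h'
  obtain ⟨z, rfl⟩ := exists_add_of_le h'.le
  have hz : 0 < z := by
    rw [pos_iff_ne_zero]
    rintro rfl
    simp at h'
  rcases hK.out.one_le_of_pos z hz with h1 | h1
  · rw [← h1, one_eq] at h
    exact lt_irrefl _ h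
  · exact lt_asymm h (by gcongr; exact h1)

theorem add_one_le_iff' {x y : K} : x + 1 ≤ y ↔ x < y := by
  rw [← not_lt, lt_add_one_iff', not_le]

theorem exists_eq_add_one {x : K} (h : x ≠ 0) : ∃ y, x = y + 1 := by
  have : 0 + 1 ≤ x := add_one_le_iff'.2 (pos_iff_ne_zero.2 h)
  obtain ⟨y, rfl⟩ := exists_add_of_le this
  exact ⟨y, by rw [zero_add, add_comm]⟩

end Algebra

/-! ### Reflection -/

section Reflection

variable {K : Type*} [ArithStructure K] [hK : Fact (ModelsISigma1 K)]

theorem below_mono {z z' : K} (h : z ≤ z') : below z ⊆ below z' := fun _ hx => lt_of_lt_of_le hx h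

/-- Σ₁-collection by induction on the length of the initial part already handled. The disjunct `n <
x` replaces the premise `x ≤ n`, so that the induction formula stays negation free; later inductions
use the same device. -/
theorem Fm.collection {C : Type*} (κ : C → K) (f : Fm C) (ρ : ℕ → K) (n : K)
    (h : ∀ a < n, ∃ z, f.eval (below z) κ (scons a ρ)) :
    ∃ z, ∀ a < n, f.eval (below z) κ (scons a ρ) := by
  let g : Fm K := .or (.lt (.const n) (.var 0)) (.ball (.var 0)
    (f.subst (fun c => .const (κ c)) (scons (.var 0) fun k => .const (ρ k))))
  have key : ∀ z x, g.eval (below z) id (scons x fun _ => 0) ↔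
      n < x ∨ ∀ a < x, f.eval (below z) κ (scons a ρ) := by
    intro z x
    simp only [g, Fm.eval, Tm.eval, scons_zero, Fm.eval_subst, id]
    refine or_congr_right (forall₂_congr fun a _ => ?_)
    have : (fun k => (scons (Tm.var 0) (fun k => Tm.const (ρ k)) k).eval id
        (scons a (scons x fun _ => (0 : K)))) = scons a ρ := by
      funext k
      cases k <;> rfl
    rw [this]
  have := hK.out.induction_eval g
  simp only [key, succ_eq] at this
  obtain ⟨z, hz⟩ := this ⟨0, .inr fun a ha => absurd ha not_lt_zero⟩ (by
    rintro x ⟨z, hz⟩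
    rcases lt_or_ge x n with hx | hx
    · obtain ⟨z', hz'⟩ := h x hx
      refine ⟨max z z', .inr fun a ha => ?_⟩
      rcases (lt_add_one_iff'.1 ha).lt_or_eq with ha | rfl
      · exact Fm.eval_mono (below_mono (le_max_left _ _)) (hz.resolve_left hx.not_gt a ha)
      · exact Fm.eval_mono (below_mono (le_max_right _ _)) hz'
    · exact ⟨0, .inl (lt_add_one_iff'.2 hx)⟩) n
  exact ⟨z, hz.resolve_left (lt_irrefl n)⟩

/-- A formula with unbounded existential quantifiers holds iff it does with these quantifiers
bounded by some element. -/
theorem Fm.eval_univ_iff {C : Type*} (κ : C → K) (f : Fm C) : ∀ ρ : ℕ → K,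
    f.eval Set.univ κ ρ ↔ ∃ z, f.eval (below z) κ ρ := by
  intro ρ
  refine ⟨?_, fun ⟨z, hz⟩ => Fm.eval_mono (Set.subset_univ _) hz⟩
  induction f generalizing ρ with
  | eq s t => exact fun h => ⟨0, h⟩
  | lt s t => exact fun h => ⟨0, h⟩
  | and f g hf hg =>
    intro h
    obtain ⟨z, hz⟩ := hf ρ h.1
    obtain ⟨z', hz'⟩ := hg ρ h.2
    exact ⟨max z z', Fm.eval_mono (below_mono (le_max_left _ _)) hz,
      Fm.eval_mono (below_mono (le_max_right _ _)) hz'⟩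
  | or f g hf hg =>
    rintro (h | h)
    · obtain ⟨z, hz⟩ := hf ρ h
      exact ⟨z, .inl hz⟩
    · obtain ⟨z, hz⟩ := hg ρ h
      exact ⟨z, .inr hz⟩
  | ball t f hf =>
    intro h
    exact Fm.collection κ f ρ _ fun a ha => hf _ (h a ha)
  | bex t f hf =>
    rintro ⟨a, ha, h⟩
    obtain ⟨z, hz⟩ := hf _ h
    exact ⟨z, a, ha, hz⟩
  | ex f hf =>
    rintro ⟨a, -, h⟩
    obtain ⟨z, hz⟩ := hf _ h
    exact ⟨max z (a + 1), a, lt_of_lt_of_le (lt_add_one a) (le_max_right _ _),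
      Fm.eval_mono (below_mono (le_max_left _ _)) hz⟩

end Reflection

/-! ### Definability with parameters -/

section Definability

variable {K : Type*} [ArithStructure K]

/-- A function of environments given by a term with parameters. -/
class IsTm (t : (ℕ → K) → K) : Prop where
  out : ∃ s : Tm K, ∀ ρ, t ρ = s.eval id ρ

/-- A relation of environments definable by a `Σ₁`-formula with parameters. -/
class S1 (R : (ℕ → K) → Prop) : Prop where
  out : ∃ f : Fm K, ∀ ρ, R ρ ↔ f.eval Set.univ id ρ

instance IsTm.var (k : ℕ) : IsTm (fun ρ : ℕ → K => ρ k) := ⟨.var k, fun _ => rfl⟩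
instance (priority := high) IsTm.const (c : K) : IsTm (fun _ : ℕ → K => c) :=
  ⟨.const c, fun _ => rfl⟩
instance IsTm.add {s t : (ℕ → K) → K} [hs : IsTm s] [ht : IsTm t] :
    IsTm (fun ρ => s ρ + t ρ) := by
  obtain ⟨s', hs⟩ := hs
  obtain ⟨t', ht⟩ := ht
  exact ⟨.add s' t', fun ρ => by rw [hs, ht]; rfl⟩
instance IsTm.mul {s t : (ℕ → K) → K} [hs : IsTm s] [ht : IsTm t] :
    IsTm (fun ρ => s ρ * t ρ) := by
  obtain ⟨s', hs⟩ := hs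
  obtain ⟨t', ht⟩ := ht
  exact ⟨.mul s' t', fun ρ => by rw [hs, ht]; rfl⟩

instance (priority := low) IsTm.rename {s : (ℕ → K) → K} {e : ℕ → ℕ} [hs : IsTm s] :
    IsTm (fun ρ => s (fun k => ρ (e k))) := by
  obtain ⟨s', hs⟩ := hs
  exact ⟨s'.subst .const (fun k => .var (e k)), fun ρ => by rw [hs, Tm.eval_subst]; rfl⟩
instance (priority := low) S1.rename {R : (ℕ → K) → Prop} {e : ℕ → ℕ} [hR : S1 R] :
    S1 (fun ρ => R (fun k => ρ (e k))) := by
  obtain ⟨f, hf⟩ := hR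
  exact ⟨f.subst .const (fun k => .var (e k)), fun ρ => by rw [hf, Fm.eval_subst]; rfl⟩

instance S1.eq {s t : (ℕ → K) → K} [hs : IsTm s] [ht : IsTm t] : S1 (fun ρ => s ρ = t ρ) := by
  obtain ⟨s', hs⟩ := hs
  obtain ⟨t', ht⟩ := ht
  exact ⟨.eq s' t', fun ρ => by rw [hs, ht]; rfl⟩
instance S1.lt {s t : (ℕ → K) → K} [hs : IsTm s] [ht : IsTm t] : S1 (fun ρ => s ρ < t ρ) := by
  obtain ⟨s', hs⟩ := hs
  obtain ⟨t', ht⟩ := ht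
  exact ⟨.lt s' t', fun ρ => by rw [hs, ht]; rfl⟩
instance S1.and {P Q : (ℕ → K) → Prop} [hP : S1 P] [hQ : S1 Q] :
    S1 (fun ρ => P ρ ∧ Q ρ) := by
  obtain ⟨f, hf⟩ := hP
  obtain ⟨g, hg⟩ := hQ
  exact ⟨.and f g, fun ρ => by rw [hf, hg]; rfl⟩
instance S1.or {P Q : (ℕ → K) → Prop} [hP : S1 P] [hQ : S1 Q] :
    S1 (fun ρ => P ρ ∨ Q ρ) := by
  obtain ⟨f, hf⟩ := hP
  obtain ⟨g, hg⟩ := hQ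
  exact ⟨.or f g, fun ρ => by rw [hf, hg]; rfl⟩
instance S1.ball {t : (ℕ → K) → K} {R : (ℕ → K) → K → Prop} [ht : IsTm t]
    [hR : S1 (fun ρ => R (fun k => ρ (k + 1)) (ρ 0))] :
    S1 (fun ρ => ∀ a, a < t ρ → R ρ a) := by
  obtain ⟨s, hs⟩ := ht
  obtain ⟨f, hf⟩ := hR
  exact ⟨.ball s f, fun ρ => by
    simp only [Fm.eval, ← hs, ← hf]; rfl⟩
instance S1.ex {R : (ℕ → K) → K → Prop} [hR : S1 (fun ρ => R (fun k => ρ (k + 1)) (ρ 0))] :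
    S1 (fun ρ => ∃ a, R ρ a) := by
  obtain ⟨f, hf⟩ := hR
  exact ⟨.ex f, fun ρ => by
    simp only [Fm.eval, Set.mem_univ, true_and, ← hf]; rfl⟩
instance S1.mem_below {s t : (ℕ → K) → K} [IsTm s] [IsTm t] : S1 (fun ρ => s ρ ∈ below (t ρ)) :=
  S1.lt

theorem S1.congr {P Q : (ℕ → K) → Prop} (hP : S1 P) (h : ∀ ρ, Q ρ ↔ P ρ) : S1 Q := by
  rwa [funext fun ρ => propext (h ρ)]

instance S1.beta {s t i v : (ℕ → K) → K} [IsTm s] [IsTm t] [IsTm i] [IsTm v] :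
    S1 (fun ρ => Beta (s ρ) (t ρ) (i ρ) (v ρ)) := by
  unfold Beta
  infer_instance

instance S1.exp {x y : (ℕ → K) → K} [IsTm x] [IsTm y] :
    S1 (fun ρ => Exp (x ρ) (y ρ)) := by
  unfold Exp
  infer_instance

end Definability

/-! ### Σ₁- and Π₁-induction, collection and overspill -/

section Induction

variable {K : Type*} [ArithStructure K] [hK : Fact (ModelsISigma1 K)]

instance {s t : (ℕ → K) → K} [IsTm s] [IsTm t] : S1 (fun ρ => s ρ ≤ t ρ) := S1.or
instance {s t : (ℕ → K) → K} [IsTm s] [IsTm t] : S1 (fun ρ => s ρ ≠ t ρ) :=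
  S1.congr (P := fun ρ => s ρ < t ρ ∨ t ρ < s ρ) inferInstance fun _ => ne_iff_lt_or_gt

theorem sigma1_induction (R : K → Prop) [hR : S1 (fun ρ => R (ρ 0))] (h0 : R 0)
    (hs : ∀ x, R x → R (x + 1)) (x : K) : R x := by
  obtain ⟨f, hf⟩ := hR
  have key : ∀ x, R x ↔ ∃ z, f.eval (below z) id (scons x fun _ => 0) := fun x =>
    (hf (scons x fun _ => 0)).trans (Fm.eval_univ_iff _ _ _)
  have := hK.out.induction_eval f
  simp only [← key, succ_eq] at this
  exact this h0 hs x

/-- A set whose complement is `Σ₁`-definable contains everything if it is inductive. -/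
theorem pi1_induction (R : K → Prop) [S1 (fun ρ => ¬ R (ρ 0))] (h0 : R 0)
    (hs : ∀ x, R x → R (x + 1)) (x : K) : R x := by
  by_contra hx
  -- A failure at `x` is pushed downwards: Σ₁-induction on `y` shows that `R` fails at `x - y` as
  -- long as `y ≤ x`, and `y = x` contradicts `h0`.
  have hx' : ∀ y, (∃ z, z + y = x ∧ ¬ R z) ∨ x < y := by
    apply sigma1_induction
    · exact .inl ⟨x, add_zero x, hx⟩
    · rintro y (⟨z, rfl, hz⟩ | h)
      · rcases eq_or_ne z 0 with rfl | h
        · exact absurd h0 hz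
        · obtain ⟨w, rfl⟩ := exists_eq_add_one h
          exact .inl ⟨w, by ring, fun hw => hz (hs w hw)⟩
      · exact .inr (h.trans (lt_add_one y))
  obtain ⟨z, hz, hz'⟩ := (hx' x).resolve_right (lt_irrefl x)
  rw [add_eq_right] at hz
  exact hz' (hz ▸ h0)

theorem sigma1_collection (R : K → K → Prop) [hR : S1 (fun ρ => R (ρ 0) (ρ 1))] (n : K)
    (h : ∀ a < n, ∃ z, R a z) : ∃ b, ∀ a < n, ∃ z < b, R a z := by
  -- Truncated subtraction makes `1 - k` swap the variables `0` and `1`; the others do not occur.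
  have : S1 (fun ρ => R (ρ 1) (ρ 0)) :=
    S1.rename (R := fun ρ => R (ρ 0) (ρ 1)) (e := fun k => 1 - k)
  have := sigma1_induction (fun x => n < x ∨ ∃ b, ∀ a < x, ∃ z < b, R a z)
    (.inr ⟨0, fun a ha => absurd ha not_lt_zero⟩) (by
      rintro x (hx | ⟨b, hb⟩)
      · exact .inl (hx.trans (lt_add_one x))
      · rcases lt_or_ge x n with hx | hx
        · obtain ⟨z, hz⟩ := h x hx
          refine .inr ⟨max b (z + 1), fun a ha => ?_⟩
          rcases (lt_add_one_iff'.1 ha).lt_or_eq with ha | rfl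
          · obtain ⟨w, hw, hw'⟩ := hb a ha
            exact ⟨w, lt_max_of_lt_left hw, hw'⟩
          · exact ⟨z, lt_max_of_lt_right (lt_add_one z), hz⟩
        · exact .inl (lt_add_one_iff'.2 hx)) n
  exact this.resolve_left (lt_irrefl n)

/-- A nonempty `Σ₁`-definable set that is bounded has a greatest element. -/
theorem sigma1_exists_greatest (R : K → Prop) [S1 (fun ρ => R (ρ 0))] {a b : K} (ha : R a)
    (hb : ∀ x, R x → x < b) : ∃ x, R x ∧ ∀ y, R y → y ≤ x := by
  by_contra! h
  have := sigma1_induction (fun x => ∃ y, x ≤ y ∧ R y) ⟨a, zero_le, ha⟩ (by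
    rintro x ⟨y, hy, hy'⟩
    obtain ⟨z, hz, hz'⟩ := h y hy'
    exact ⟨z, add_one_le_iff'.2 (hy.trans_lt hz'), hz⟩) b
  obtain ⟨y, hy, hy'⟩ := this
  exact absurd (hb y hy') hy.not_gt

/-- A `Σ₁`-definable set containing a set that is not everything but closed under successor
contains a further element. -/
theorem sigma1_overspill (R : K → Prop) [S1 (fun ρ => R (ρ 0))] {I : Set K} (h0 : 0 ∈ I)
    (hs : ∀ x ∈ I, x + 1 ∈ I) (hI : I ≠ Set.univ) (h : ∀ x ∈ I, R x) : ∃ x ∉ I, R x := by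
  by_contra! H
  have hx : ∀ x, R x → x ∈ I := fun x hx => by
    by_contra h'
    exact H x h' hx
  exact hI (Set.eq_univ_of_forall fun x => hx x
    (sigma1_induction R (h 0 h0) (fun y hy => h _ (hs y (hx y hy))) x))

/-- Needed in `Transfers.back`, where the property that spills over says that codes are false. -/
theorem pi1_overspill (R : K → Prop) [S1 (fun ρ => ¬ R (ρ 0))] {I : Set K} (h0 : 0 ∈ I)
    (hs : ∀ x ∈ I, x + 1 ∈ I) (hI : I ≠ Set.univ) (h : ∀ x ∈ I, R x) : ∃ x ∉ I, R x := by
  by_contra! H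
  have hx : ∀ x, R x → x ∈ I := fun x hx => by
    by_contra h'
    exact H x h' hx
  exact hI (Set.eq_univ_of_forall fun x => hx x
    (pi1_induction R (h 0 h0) (fun y hy => h _ (hs y (hx y hy))) x))

end Induction

section Arithmetic

variable {K : Type*} [ArithStructure K] [hK : Fact (ModelsISigma1 K)]

/-! ### Division, coprimality and the `β`-function -/

theorem exists_div_mod (s : K) {m : K} (hm : 0 < m) : ∃ q v, v < m ∧ s = q * m + v := by
  refine sigma1_induction (fun s => ∃ q v, v < m ∧ s = q * m + v) ⟨0, 0, hm, by ring⟩ ?_ s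
  rintro x ⟨q, v, hv, rfl⟩
  rcases (add_one_le_iff'.2 hv).lt_or_eq with h | h
  · exact ⟨q, v + 1, h, by ring⟩
  · exact ⟨q + 1, 0, hm, by rw [← h]; ring⟩

theorem div_mod_le {q q' m v v' : K} (hv : v < m) (h : q * m + v = q' * m + v') : q' ≤ q := by
  by_contra! hq
  obtain ⟨d, rfl⟩ := exists_add_of_le (add_one_le_iff'.2 hq)
  have : v = m + (d * m + v') := by
    have : q * m + v = q * m + (m + (d * m + v')) := by rw [h]; ring
    exact add_left_cancel this
  exact absurd (this ▸ le_self_add : m ≤ v) hv.not_ge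

theorem div_mod_unique {q q' m v v' : K} (hv : v < m) (hv' : v' < m)
    (h : q * m + v = q' * m + v') : q = q' ∧ v = v' := by
  obtain rfl : q = q' := le_antisymm (div_mod_le hv' h.symm) (div_mod_le hv h)
  exact ⟨rfl, add_left_cancel h⟩

theorem Beta.unique {s t i v v' : K} (h : Beta s t i v) (h' : Beta s t i v') : v = v' := by
  obtain ⟨hv, q, hq⟩ := h
  obtain ⟨hv', q', hq'⟩ := h'
  exact (div_mod_unique hv hv' (hq.symm.trans hq')).2

theorem exists_beta_value (s t i : K) : ∃ v, Beta s t i v := by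
  obtain ⟨q, v, hv, h⟩ := exists_div_mod s (m := one K + (i + one K) * t)
    (lt_of_lt_of_le one_pos le_self_add)
  exact ⟨v, hv, q, h⟩

/-- `a` is invertible modulo `m`. -/
def InvMod (a m : K) : Prop := ∃ u v, u * a = v * m + 1

theorem InvMod.mul {a b m : K} (ha : InvMod a m) (hb : InvMod b m) : InvMod (a * b) m := by
  obtain ⟨u, v, h⟩ := ha
  obtain ⟨u', v', h'⟩ := hb
  refine ⟨u * u', v * v' * m + v + v', ?_⟩
  calc u * u' * (a * b) = (u * a) * (u' * b) := by ring
    _ = _ := by rw [h, h']; ring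

/-- If `u(a+1) = v(m+1) + 1`, then `-v` inverts `m+1` modulo `a+1`. As `a ≡ -1`, `v * a` serves
instead; the extra summand `a + 1` avoids a subtraction in the quotient. -/
theorem InvMod.symm {a m : K} (h : InvMod (a + 1) (m + 1)) : InvMod (m + 1) (a + 1) := by
  obtain ⟨u, v, h⟩ := h
  refine ⟨v * a + (a + 1), a * u + m, ?_⟩
  calc (v * a + (a + 1)) * (m + 1) = a * (v * (m + 1) + 1) + a * m + m + 1 := by ring
    _ = (a * u + m) * (a + 1) + 1 := by rw [← h]; ring

/-- Modulo `1 + (i+1)t` one has `(i+1)t ≡ -1`, and the other modulus is congruent to `(d+1)t`. With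
`t = (d+1)e`, multiplying it by `(i+1)²e` gives `((i+1)t)² ≡ 1`. -/
theorem invMod_of_lt {t i d : K} (ht : t ≠ 0) (h : ∃ e, t = (d + 1) * e) :
    InvMod (1 + ((i + d + 1) + 1) * t) (1 + (i + 1) * t) := by
  obtain ⟨e, rfl⟩ := h
  obtain ⟨e, rfl⟩ := exists_eq_add_one (x := e) (by rintro rfl; simp at ht)
  obtain ⟨v, hv⟩ := exists_eq_add_one (x := (i + 1) * ((i + d + 1) + 1) * (e + 1))
    (by positivity)
  refine ⟨(i + 1) * (i + 1) * (e + 1), v, ?_⟩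
  refine add_right_cancel (b := 1 + (i + 1) * ((d + 1) * (e + 1))) ?_
  calc _ = (v + 1) * (1 + (i + 1) * ((d + 1) * (e + 1))) + 1 := by rw [← hv]; ring
    _ = _ := by ring

theorem exists_common_multiple (n : K) : ∃ t : K, t ≠ 0 ∧ ∀ d < n, ∃ e, t = (d + 1) * e := by
  refine sigma1_induction (fun n => ∃ t : K, t ≠ 0 ∧ ∀ d < n, ∃ e, t = (d + 1) * e)
    ⟨1, one_ne_zero, fun d hd => absurd hd not_lt_zero⟩ ?_ n
  rintro n ⟨t, ht, h⟩
  refine ⟨(n + 1) * t, by positivity, fun d hd => ?_⟩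
  rcases (lt_add_one_iff'.1 hd).lt_or_eq with hd | rfl
  · obtain ⟨e, he⟩ := h d hd
    exact ⟨(n + 1) * e, by rw [he]; ring⟩
  · exact ⟨t, rfl⟩

/-- With `m = n + 1`, the element `n * s` stands in for `-s` modulo `m`, so `z = u(y + n s)` solves
the congruence without subtraction. -/
theorem exists_chinese_remainder {s P m u v y : K} (hm : m ≠ 0) (h : u * P = v * m + 1) :
    ∃ z q, s + P * z = q * m + y := by
  obtain ⟨n, rfl⟩ := exists_eq_add_one hm
  refine ⟨u * (y + n * s), v * (y + n * s) + s, ?_⟩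
  calc s + P * (u * (y + n * s)) = s + (u * P) * (y + n * s) := by ring
    _ = _ := by rw [h]; ring

/-- Sequences given by a `Σ₁`-relation with bounded values are `β`-coded. -/
theorem exists_beta (R : K → K → Prop) [hR : S1 (fun ρ => R (ρ 0) (ρ 1))] (n w : K)
    (h : ∀ i < n, ∃ v < w, R i v) : ∃ s t, ∀ i < n, ∃ v, R i v ∧ Beta s t i v := by
  have : S1 (fun ρ => R (ρ 1) (ρ 0)) :=
    S1.rename (R := fun ρ => R (ρ 0) (ρ 1)) (e := fun k => 1 - k)
  obtain ⟨t₀, ht₀, hd⟩ := exists_common_multiple n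
  rcases eq_or_ne w 0 with rfl | hw
  · refine ⟨0, 0, fun i hi => ?_⟩
    obtain ⟨v, hv, -⟩ := h i hi
    exact absurd hv not_lt_zero
  -- The factor `t₀` makes the moduli `1 + (i+1)t` pairwise coprime; the factor `w` makes each
  -- modulus large enough for remainders below `w`.
  set t := w * t₀ with ht
  have ht0 : t ≠ 0 := by positivity
  have hdt : ∀ d < n, ∃ e, t = (d + 1) * e := fun d hd' => by
    obtain ⟨e, he⟩ := hd d hd'
    exact ⟨w * e, by rw [ht, he]; ring⟩
  have hwt : w ≤ t := by
    obtain ⟨t₁, rfl⟩ := exists_eq_add_one ht₀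
    rw [ht, mul_add, mul_one]
    exact le_add_self
  have hinv : ∀ i j, i < j → j < n → InvMod (1 + (i + 1) * t) (1 + (j + 1) * t) := by
    intro i j hij hj
    obtain ⟨d, rfl⟩ := exists_add_of_le (add_one_le_iff'.2 hij)
    have := invMod_of_lt (i := i) (d := d) ht0 (hdt d (lt_of_le_of_lt le_add_self hj))
    rw [show i + 1 + d = i + d + 1 by ring]
    rw [add_comm 1, add_comm 1] at this ⊢
    exact this.symm
  -- `P` plays the role of the product of the first `k` moduli. Only two properties are kept:
  -- divisibility by those moduli and invertibility modulo the later ones. No coded products are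
  -- needed.
  have hG := sigma1_induction (fun k => n < k ∨ ∃ s P, (∀ i < k, ∃ v, R i v ∧ Beta s t i v) ∧
      (∀ i < k, ∃ q, P = q * (1 + (i + 1) * t)) ∧
      ∀ j < n, j < k ∨ ∃ u v, u * P = v * (1 + (j + 1) * t) + 1)
    (.inr ⟨0, 1, fun i hi => absurd hi not_lt_zero, fun i hi => absurd hi not_lt_zero,
      fun j _ => .inr ⟨1, 0, by ring⟩⟩) ?_ n
  · obtain ⟨s, -, hs, -⟩ := hG.resolve_left (lt_irrefl n)
    exact ⟨s, t, hs⟩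
  rintro k (hk | ⟨s, P, hs, hP, hI⟩)
  · exact .inl (hk.trans (lt_add_one k))
  rcases le_or_gt n k with hk | hk
  · exact .inl (lt_add_one_iff'.2 hk)
  obtain ⟨y, hy, hRy⟩ := h k hk
  obtain ⟨u, v, huv⟩ := (hI k hk).resolve_left (lt_irrefl k)
  obtain ⟨z, q, hz⟩ := exists_chinese_remainder (s := s) (y := y)
    (by positivity : 1 + (k + 1) * t ≠ 0) huv
  refine .inr ⟨s + P * z, P * (1 + (k + 1) * t), fun i hi => ?_, fun i hi => ?_, fun j hj => ?_⟩
  · rcases (lt_add_one_iff'.1 hi).lt_or_eq with hi | rfl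
    · obtain ⟨v, hv, hv', q', hq'⟩ := hs i hi
      obtain ⟨p, hp⟩ := hP i hi
      refine ⟨v, hv, hv', q' + p * z, ?_⟩
      rw [hp, hq', one_eq]
      ring
    · refine ⟨y, hRy, ?_, q, hz⟩
      calc y < w := hy
        _ ≤ t := hwt
        _ ≤ 1 + (i + 1) * t := by
          rw [add_mul, one_mul, ← add_assoc]
          exact le_add_self
  · rcases (lt_add_one_iff'.1 hi).lt_or_eq with hi | rfl
    · obtain ⟨p, rfl⟩ := hP i hi
      exact ⟨p * (1 + (k + 1) * t), by ring⟩
    · exact ⟨P, rfl⟩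
  · rcases lt_or_ge k j with hkj | hkj
    · exact .inr (InvMod.mul ((hI j hj).resolve_left hkj.not_gt) (hinv k j hkj hj))
    · exact .inl (lt_add_one_iff'.2 hkj)

/-! ### Exponentiation -/

theorem exp_zero_iff {y : K} : Exp 0 y ↔ y = 1 := by
  constructor
  · rintro ⟨s, t, h0, -, h⟩
    exact h.unique h0
  · rintro rfl
    obtain ⟨s, t, h⟩ := exists_beta (fun _ v : K => v = 1) 1 2
      (fun i _ => ⟨1, one_lt_two, rfl⟩)
    obtain ⟨_, rfl, h⟩ := h 0 one_pos
    exact ⟨s, t, h, fun i hi => absurd hi not_lt_zero, h⟩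

/-- A β-coded sequence cannot be prolonged in place. The relation `R` reads the old sequence and
adds one entry, collection bounds its values, and `exists_beta` codes it afresh. -/
theorem Exp.double {x y : K} (h : Exp x y) : Exp (x + 1) (y + y) := by
  obtain ⟨s, t, h0, hs, h⟩ := h
  let R : K → K → Prop := fun i v => i < x + 1 ∧ Beta s t i v ∨ i = x + 1 ∧ v = y + y
  have hR : S1 (fun ρ => R (ρ 0) (ρ 1)) := by
    show S1 (fun ρ : ℕ → K =>
      ρ 0 < x + 1 ∧ Beta s t (ρ 0) (ρ 1) ∨ ρ 0 = x + 1 ∧ ρ 1 = y + y)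
    infer_instance
  have hR' : ∀ i < x + 1 + 1, ∃ v, R i v := by
    intro i hi
    rcases (lt_add_one_iff'.1 hi).lt_or_eq with hi | rfl
    · obtain ⟨v, hv⟩ := exists_beta_value s t i
      exact ⟨v, .inl ⟨hi, hv⟩⟩
    · exact ⟨y + y, .inr ⟨rfl, rfl⟩⟩
  obtain ⟨w, hw⟩ := sigma1_collection R _ hR'
  obtain ⟨s', t', h'⟩ := exists_beta R _ w hw
  have key : ∀ i < x + 1, ∀ v, Beta s t i v → Beta s' t' i v := by
    intro i hi v hv
    obtain ⟨v', (⟨-, h1⟩ | ⟨rfl, -⟩), h2⟩ := h' i (hi.trans (lt_add_one _))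
    · rwa [hv.unique h1]
    · exact absurd hi (lt_irrefl _)
  have key' : Beta s' t' (x + 1) (y + y) := by
    obtain ⟨v', (⟨h1, -⟩ | ⟨-, rfl⟩), h2⟩ := h' (x + 1) (lt_add_one _)
    · exact absurd h1 (lt_irrefl _)
    · exact h2
  refine ⟨s', t', key 0 (lt_add_one_iff'.2 zero_le) _ h0, fun i hi => ?_, key'⟩
  rcases (lt_add_one_iff'.1 hi).lt_or_eq with hi | rfl
  · obtain ⟨v, hv, hv'⟩ := hs i hi
    exact ⟨v, key i (hi.trans (lt_add_one x)) v hv, key _ (by rw [one_eq]; gcongr) _ hv'⟩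
  · exact ⟨y, key i (lt_add_one i) y h, key'⟩

theorem exists_exp (x : K) : ∃ y, Exp x y :=
  sigma1_induction (fun x => ∃ y, Exp x y) ⟨1, exp_zero_iff.2 rfl⟩
    (fun _ ⟨y, hy⟩ => ⟨y + y, hy.double⟩) x

theorem Exp.unique {x y y' : K} (h : Exp x y) (h' : Exp x y') : y = y' := by
  obtain ⟨s, t, h0, hs, h⟩ := h
  obtain ⟨s', t', h0', hs', h'⟩ := h'
  have := sigma1_induction (fun i => x < i ∨ ∃ v, Beta s t i v ∧ Beta s' t' i v)
    (.inr ⟨1, h0, h0'⟩) (by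
      rintro i (hi | ⟨v, hv, hv'⟩)
      · exact .inl (hi.trans (lt_add_one i))
      · rcases lt_or_ge i x with hi | hi
        · obtain ⟨w, hw, hw1⟩ := hs i hi
          obtain ⟨w', hw', hw1'⟩ := hs' i hi
          rw [← hv.unique hw] at hw1
          rw [← hv'.unique hw'] at hw1'
          exact .inr ⟨v + v, hw1, hw1'⟩
        · exact .inl (lt_add_one_iff'.2 hi)) x
  obtain ⟨v, hv, hv'⟩ := this.resolve_left (lt_irrefl x)
  exact (h.unique hv).trans (hv'.unique h')

/-- The power `2 ^ x`. -/
noncomputable def pow2 (x : K) : K := (exists_exp x).choose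

theorem exp_pow2 (x : K) : Exp x (pow2 x) := (exists_exp x).choose_spec

theorem exp_iff {x y : K} : Exp x y ↔ y = pow2 x :=
  ⟨fun h => h.unique (exp_pow2 x), fun h => h ▸ exp_pow2 x⟩

theorem pow2_succ (x : K) : pow2 (x + 1) = pow2 x + pow2 x := (exp_iff.1 (exp_pow2 x).double).symm

theorem lt_pow2 (x : K) : x < pow2 x := by
  have := sigma1_induction (fun x => ∃ y, Exp x y ∧ x < y) ⟨1, exp_zero_iff.2 rfl, one_pos⟩ (by
    rintro x ⟨y, hy, hxy⟩
    exact ⟨y + y, hy.double,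
      add_lt_add_of_lt_of_le hxy (le_add_self.trans (add_one_le_iff'.2 hxy))⟩) x
  obtain ⟨y, hy, h⟩ := this
  rwa [exp_iff.1 hy] at h

theorem pow2_add (x y : K) : pow2 (x + y) = pow2 x * pow2 y := by
  have := sigma1_induction (fun y => ∃ p, Exp y p ∧ Exp (x + y) (pow2 x * p))
    ⟨1, exp_zero_iff.2 rfl, by rw [add_zero, mul_one]; exact exp_pow2 x⟩ (by
    rintro y ⟨p, hp, h⟩
    refine ⟨p + p, hp.double, ?_⟩
    rw [← add_assoc, mul_add]
    exact h.double) y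
  obtain ⟨p, hp, h⟩ := this
  rw [exp_iff.1 hp] at h
  exact (exp_iff.1 h).symm

theorem pow2_pos (x : K) : 0 < pow2 x := lt_of_le_of_lt zero_le (lt_pow2 x)

/-- A higher power of two is an even multiple of a lower one. -/
theorem exists_pow2_eq {x y : K} (h : x < y) : ∃ d, 0 < d ∧ pow2 y = (d + d) * pow2 x := by
  obtain ⟨z, rfl⟩ := exists_add_of_le (add_one_le_iff'.2 h)
  exact ⟨pow2 z, pow2_pos z, by rw [pow2_add, pow2_succ]; ring⟩

theorem pow2_strictMono : StrictMono (pow2 : K → K) := by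
  intro x y h
  obtain ⟨d, hd, h⟩ := exists_pow2_eq h
  have : 1 ≤ d := by
    have := add_one_le_iff'.2 hd
    rwa [zero_add] at this
  rw [h, add_mul]
  have h1 : pow2 x ≤ d * pow2 x := le_mul_of_one_le_left zero_le this
  exact lt_of_le_of_lt h1 (lt_add_of_pos_left _ (lt_of_lt_of_le (pow2_pos x) h1))

/-! ### Binary digits -/

/-- The `x`-th binary digit of `y` is `0`. -/
def AckNMem {M : Type*} [ArithStructure M] (x y : M) : Prop :=
  ∃ p : M, Exp x p ∧ ∃ q r : M, r < p ∧ y = (q + q) * p + r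

instance S1.ackMem {x y : (ℕ → K) → K} [IsTm x] [IsTm y] :
    S1 (fun ρ => AckMem (x ρ) (y ρ)) := by
  unfold AckMem
  infer_instance

instance S1.ackNMem {x y : (ℕ → K) → K} [IsTm x] [IsTm y] :
    S1 (fun ρ => AckNMem (x ρ) (y ρ)) := by
  unfold AckNMem
  infer_instance

theorem ackMem_iff {x y : K} :
    AckMem x y ↔ ∃ q r, r < pow2 x ∧ y = (q + q + 1) * pow2 x + r := by
  simp only [AckMem, exp_iff, exists_eq_left, one_eq]

theorem ackNMem_iff' {x y : K} :
    AckNMem x y ↔ ∃ q r, r < pow2 x ∧ y = (q + q) * pow2 x + r := by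
  simp only [AckNMem, exp_iff, exists_eq_left]

theorem even_or_odd (q : K) : (∃ d, q = d + d) ∨ ∃ d, q = d + d + 1 := by
  refine sigma1_induction (fun q : K => (∃ d, q = d + d) ∨ ∃ d, q = d + d + 1)
    (.inl ⟨0, by ring⟩) ?_ q
  rintro x (⟨d, rfl⟩ | ⟨d, rfl⟩)
  · exact .inr ⟨d, rfl⟩
  · exact .inl ⟨d + 1, by ring⟩

theorem double_ne_double_add_one (q d : K) : q + q ≠ d + d + 1 := by
  intro h
  rcases lt_trichotomy q d with hq | rfl | hq
  · exact absurd h ((add_lt_add hq hq).trans (lt_add_one _)).ne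
  · exact absurd h (lt_add_one _).ne
  · have := add_one_le_iff'.2 hq
    refine absurd h (ne_of_gt (lt_of_lt_of_le ?_ (add_le_add this this)))
    rw [show d + 1 + (d + 1) = d + d + 1 + 1 by ring]
    exact lt_add_one _

/-- Both membership and its negation are thus Σ₁, so digits may be tested negatively in
negation-free formulas. -/
theorem ackNMem_iff {x y : K} : AckNMem x y ↔ ¬ AckMem x y := by
  rw [ackNMem_iff', ackMem_iff]
  constructor
  · rintro ⟨q, r, hr, rfl⟩ ⟨q', r', hr', h⟩
    exact double_ne_double_add_one _ _ (div_mod_unique hr hr' h).1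
  · intro h
    obtain ⟨q, r, hr, rfl⟩ := exists_div_mod y (pow2_pos x)
    rcases even_or_odd q with ⟨d, rfl⟩ | ⟨d, rfl⟩
    · exact ⟨d, r, hr, rfl⟩
    · exact absurd ⟨d, r, hr, rfl⟩ h

theorem AckMem.pow2_le {x y : K} (h : AckMem x y) : pow2 x ≤ y := by
  obtain ⟨q, r, -, rfl⟩ := ackMem_iff.1 h
  rw [add_mul, one_mul, add_assoc]
  exact le_add_left le_self_add

theorem AckMem.lt {x y : K} (h : AckMem x y) : x < y := (lt_pow2 x).trans_le h.pow2_le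

theorem not_ackMem_zero (x : K) : ¬ AckMem x 0 := fun h => not_lt_zero h.lt

/-- Adding a multiple of a power of two does not change the lower digits. -/
theorem ackMem_add_mul {j i : K} (h : j < i) (c q : K) :
    AckMem j (c + q * pow2 i) ↔ AckMem j c := by
  obtain ⟨d, -, hd⟩ := exists_pow2_eq h
  have key : ∀ c, AckMem j c → AckMem j (c + q * pow2 i) := by
    intro c hc
    obtain ⟨q', r, hr, rfl⟩ := ackMem_iff.1 hc
    exact ackMem_iff.2 ⟨q' + q * d, r, hr, by rw [hd]; ring⟩
  refine ⟨fun hc => ?_, key c⟩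
  by_contra hc'
  rw [← ackNMem_iff, ackNMem_iff'] at hc'
  obtain ⟨q', r, hr, rfl⟩ := hc'
  refine ackNMem_iff.1 (ackNMem_iff'.2 ⟨q' + q * d, r, hr, ?_⟩) hc
  rw [hd]
  ring

/-- Adding a power of two that is not among the digits adds one digit. -/
theorem ackMem_add_pow2 {i c : K} (h : ¬ AckMem i c) (j : K) :
    AckMem j (c + pow2 i) ↔ AckMem j c ∨ j = i := by
  rcases lt_trichotomy j i with hj | rfl | hj
  · have := ackMem_add_mul hj c 1
    rw [one_mul] at this
    rw [this, or_iff_left hj.ne]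
  · rw [← ackNMem_iff, ackNMem_iff'] at h
    obtain ⟨q, r, hr, rfl⟩ := h
    simp only [or_true, iff_true]
    exact ackMem_iff.2 ⟨q, r, hr, by ring⟩
  · rw [or_iff_left hj.ne']
    obtain ⟨d, hd0, hd⟩ := exists_pow2_eq hj
    obtain ⟨q, r, hr, rfl⟩ := ackNMem_iff'.1 (ackNMem_iff.2 h)
    -- Splitting off the part of the number from `2 ^ j` upwards: the lower part has digit `i` equal
    -- to `0`, so adding `2 ^ i` to it causes no carry into position `j`.
    obtain ⟨q', s, hs, rfl⟩ := exists_div_mod q hd0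
    have hlt : s * (pow2 i + pow2 i) + r + pow2 i < pow2 j := by
      calc s * (pow2 i + pow2 i) + r + pow2 i < s * (pow2 i + pow2 i) + pow2 i + pow2 i := by
            gcongr
        _ = (s + 1) * (pow2 i + pow2 i) := by ring
        _ ≤ d * (pow2 i + pow2 i) := by gcongr; exact add_one_le_iff'.2 hs
        _ = pow2 j := by rw [hd]; ring
    have hlt' : s * (pow2 i + pow2 i) + r < pow2 j := lt_of_le_of_lt le_self_add hlt
    have e1 : (q' * d + s + (q' * d + s)) * pow2 i + r =
      q' * pow2 j + (s * (pow2 i + pow2 i) + r) := by rw [hd]; ring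
    have e2 : q' * pow2 j + (s * (pow2 i + pow2 i) + r) + pow2 i =
      q' * pow2 j + (s * (pow2 i + pow2 i) + r + pow2 i) := by ring
    rw [e1, e2]
    have : ∀ x < pow2 j, (AckMem j (q' * pow2 j + x) ↔ ∃ q, q' = q + q + 1) := by
      intro x hx
      rw [ackMem_iff]
      constructor
      · rintro ⟨q, r, hr, h⟩
        exact ⟨q, (div_mod_unique hx hr h).1⟩
      · rintro ⟨q, rfl⟩
        exact ⟨q, x, hx, rfl⟩
    rw [this _ hlt, this _ hlt']

/-- `Σ₁`-comprehension: every bounded `Σ₁`-definable set is coded. -/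
theorem exists_code (R : K → Prop) [hR : S1 (fun ρ => R (ρ 0))] (n : K) :
    ∃ c, ∀ j, AckMem j c ↔ j < n ∧ R j := by
  have : S1 (fun ρ => R (ρ 0)) := hR
  -- The greatest number below `2 ^ n` whose digits all satisfy `R` codes the whole set: a missing
  -- digit could be added to give a greater one.
  obtain ⟨c, ⟨hc, hc'⟩, hmax⟩ := sigma1_exists_greatest
    (fun c => c < pow2 n ∧ ∀ j < n, AckNMem j c ∨ R j) (a := 0) (b := pow2 n)
    ⟨pow2_pos n, fun j _ => .inl (ackNMem_iff.2 (not_ackMem_zero j))⟩ fun x hx => hx.1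
  refine ⟨c, fun j => ⟨fun h => ?_, fun ⟨hj, h⟩ => ?_⟩⟩
  · have hj : j < n := pow2_strictMono.lt_iff_lt.1 (h.pow2_le.trans_lt hc)
    exact ⟨hj, (hc' j hj).resolve_left fun h' => ackNMem_iff.1 h' h⟩
  · by_contra hjc
    refine absurd (hmax (c + pow2 j) ⟨?_, fun i hi => ?_⟩)
      (not_le.2 (lt_add_of_pos_right _ (pow2_pos j)))
    · obtain ⟨d, hd, hd'⟩ := exists_pow2_eq hj
      obtain ⟨q, r, hr, rfl⟩ := ackNMem_iff'.1 (ackNMem_iff.2 hjc)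
      have hq : q < d := by
        by_contra! hq
        refine absurd hc (not_lt.2 ?_)
        rw [hd']
        calc (d + d) * pow2 j ≤ (q + q) * pow2 j := by gcongr
          _ ≤ _ := le_self_add
      calc (q + q) * pow2 j + r + pow2 j < (q + q) * pow2 j + pow2 j + pow2 j := by gcongr
        _ = (q + 1 + (q + 1)) * pow2 j := by ring
        _ ≤ (d + d) * pow2 j := by gcongr <;> exact add_one_le_iff'.2 hq
        _ = pow2 n := hd'.symm
    · rw [ackNMem_iff, ackMem_add_pow2 hjc]
      rcases eq_or_ne i j with rfl | hij
      · exact .inr h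
      · rcases hc' i hi with h | h
        · exact .inl fun h' => h'.elim (ackNMem_iff.1 h) hij
        · exact .inr h

/-- The digits below `n` are those of the remainder modulo `2 ^ n`. -/
theorem exists_mod_pow2 (c n : K) :
    ∃ r, r < pow2 n ∧ ∀ j, AckMem j r ↔ j < n ∧ AckMem j c := by
  obtain ⟨q, r, hr, rfl⟩ := exists_div_mod c (pow2_pos n)
  refine ⟨r, hr, fun j => ?_⟩
  have key : ∀ j < n, (AckMem j (q * pow2 n + r) ↔ AckMem j r) := fun j hj => by
    rw [add_comm, ackMem_add_mul hj]
  constructor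
  · intro h
    have hj : j < n := pow2_strictMono.lt_iff_lt.1 (h.pow2_le.trans_lt hr)
    exact ⟨hj, (key j hj).2 h⟩
  · rintro ⟨hj, h⟩
    exact (key j hj).1 h

/-! ### Pairing -/

/-- A pairing function. -/
def pair {M : Type*} [ArithStructure M] (x y : M) : M := (x + y) * (x + y) + x

instance IsTm.pair {s t : (ℕ → K) → K} [IsTm s] [IsTm t] : IsTm (fun ρ => pair (s ρ) (t ρ)) := by
  unfold ArithModel.pair
  infer_instance

theorem le_pair_left (x y : K) : x ≤ pair x y := le_add_self

theorem le_pair_right (x y : K) : y ≤ pair x y := by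
  unfold pair
  rcases eq_or_ne (x + y) 0 with h | h
  · rw [add_eq_zero] at h
    rw [h.2]; exact zero_le
  · obtain ⟨z, hz⟩ := exists_eq_add_one h
    calc y ≤ x + y := le_add_self
      _ ≤ (x + y) * (x + y) := le_mul_of_one_le_left zero_le (hz ▸ le_add_self)
      _ ≤ _ := le_self_add

/-- The value lies in the interval from `(x+y)²` up to, but excluding, `(x+y+1)²`, hence determines
`x + y`. -/
theorem pair_inj {x y x' y' : K} : pair x y = pair x' y' ↔ x = x' ∧ y = y' := by
  refine ⟨fun h => ?_, fun ⟨h, h'⟩ => by rw [h, h']⟩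
  have key : ∀ {x y x' y' : K}, x + y < x' + y' → pair x y < pair x' y' := by
    intro x y x' y' h
    have h1 := add_one_le_iff'.2 h
    calc pair x y < (x + y + 1) * (x + y + 1) := by
          unfold pair
          rw [show (x + y + 1) * (x + y + 1) = (x + y) * (x + y) + x + (x + y + y + 1) by ring]
          exact lt_add_of_pos_right _ (by positivity)
      _ ≤ (x' + y') * (x' + y') := by gcongr
      _ ≤ _ := le_self_add
  have hs : x + y = x' + y' := by
    rcases lt_trichotomy (x + y) (x' + y') with h1 | h1 | h1
    · exact absurd h (key h1).ne
    · exact h1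
    · exact absurd h (key h1).ne'
  unfold pair at h
  rw [hs] at h
  obtain rfl := add_left_cancel h
  exact ⟨rfl, add_left_cancel hs⟩

end Arithmetic

/-! ### Relativized exponentiation and membership -/

section Relativized

variable {K : Type*} [ArithStructure K]

/-- `Beta` with the quantifier ranging over `D`. -/
def BetaD (D : Set K) (s t i v : K) : Prop :=
  v < one K + (i + one K) * t ∧ ∃ q ∈ D, s = q * (one K + (i + one K) * t) + v

/-- `Exp` with the unbounded quantifiers ranging over `D`. -/
def ExpD (D : Set K) (x y : K) : Prop :=
  ∃ s ∈ D, ∃ t ∈ D, BetaD D s t 0 (one K) ∧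
    (∀ i < x, ∃ v ∈ D, BetaD D s t i v ∧ BetaD D s t (i + one K) (v + v)) ∧ BetaD D s t x y

/-- `AckMem` with the unbounded quantifiers ranging over `D`. -/
def MemD (D : Set K) (x y : K) : Prop :=
  ∃ p ∈ D, ExpD D x p ∧ ∃ q ∈ D, ∃ r ∈ D, r < p ∧ y = (q + q + one K) * p + r

/-- `AckNMem` with the unbounded quantifiers ranging over `D`. -/
def NMemD (D : Set K) (x y : K) : Prop :=
  ∃ p ∈ D, ExpD D x p ∧ ∃ q ∈ D, ∃ r ∈ D, r < p ∧ y = (q + q) * p + r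

theorem expD_univ {x y : K} : ExpD Set.univ x y ↔ Exp x y := by
  simp [ExpD, Exp, BetaD, Beta]

theorem memD_univ {x y : K} : MemD Set.univ x y ↔ AckMem x y := by
  simp [MemD, AckMem, expD_univ]

theorem nmemD_univ {x y : K} : NMemD Set.univ x y ↔ AckNMem x y := by
  simp [NMemD, AckNMem, expD_univ]

theorem BetaD.beta {D : Set K} {s t i v : K} (h : BetaD D s t i v) : Beta s t i v :=
  ⟨h.1, h.2.imp fun _ h => h.2⟩

theorem ExpD.exp {D : Set K} {x y : K} : ExpD D x y → Exp x y := by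
  rintro ⟨s, -, t, -, h0, hs, h⟩
  refine ⟨s, t, h0.beta, fun i hi => ?_, h.beta⟩
  obtain ⟨v, -, h, h'⟩ := hs i hi
  exact ⟨v, h.beta, h'.beta⟩

theorem MemD.mem {D : Set K} {x y : K} : MemD D x y → AckMem x y := by
  rintro ⟨p, -, hp, q, -, r, -, h⟩
  exact ⟨p, hp.exp, q, r, h⟩

theorem NMemD.nmem {D : Set K} {x y : K} : NMemD D x y → AckNMem x y := by
  rintro ⟨p, -, hp, q, -, r, -, h⟩
  exact ⟨p, hp.exp, q, r, h⟩

/-! ### Game formulas -/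

/-- One step in the evaluation of the code `u` of a positive infinitary formula at the
assignment coded by `c`; `Q u' c'` stands for the truth of the subformula `u'` at `c'`. The codes
`⟨1, k, h⟩` and `⟨2, k, l, h⟩` stand for `∃ xₖ ⋀ h` and `∀ xₖ < xₗ ⋁ h`. -/
def Clause (D : Set K) (Q : K → K → Prop) (u c : K) : Prop :=
  (∃ p ∈ D, ∃ q ∈ D, ∃ r ∈ D, ∃ s ∈ D, ∃ i ∈ D,
    u = pair 0 (pair (pair p q) (pair (pair r s) i)) ∧
    ∃ x ∈ D, ∃ y ∈ D, ∃ z ∈ D, ∃ w ∈ D, MemD D (pair p x) c ∧ MemD D (pair q y) c ∧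
      MemD D (pair r z) c ∧ MemD D (pair s w) c ∧ x * y + z = w + i) ∨
  (∃ k ∈ D, ∃ h ∈ D, u = pair (one K) (pair k h) ∧
    ∃ x ∈ D, ∃ p ∈ D, ExpD D (pair k x) p ∧ ∀ v < h, NMemD D v h ∨ Q v (c + p)) ∨
  (∃ k ∈ D, ∃ l ∈ D, ∃ h ∈ D, u = pair (one K + one K) (pair (pair k l) h) ∧
    ∃ y ∈ D, MemD D (pair l y) c ∧
      ∀ x < y, ∃ p ∈ D, ExpD D (pair k x) p ∧ ∃ v < h, MemD D v h ∧ Q v (c + p))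

theorem Clause.mono {D : Set K} {Q Q' : K → K → Prop} (h : ∀ u c, Q u c → Q' u c) {u c : K} :
    Clause D Q u c → Clause D Q' u c := by
  rintro (h1 | ⟨k, hk, a, ha, hu, x, hx, p, hp, he, h1⟩ |
    ⟨k, hk, l, hl, a, ha, hu, y, hy, hm, h1⟩)
  · exact .inl h1
  · exact .inr (.inl ⟨k, hk, a, ha, hu, x, hx, p, hp, he, fun v hv => (h1 v hv).imp_right (h _ _)⟩)
  · refine .inr (.inr ⟨k, hk, l, hl, a, ha, hu, y, hy, hm, fun x hx => ?_⟩)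
    obtain ⟨p, hp, he, v, hv, hm, hQ⟩ := h1 x hx
    exact ⟨p, hp, he, v, hv, hm, h _ _ hQ⟩

/-- `W` codes a set of true pairs `⟨u, c⟩`, each of which is justified by others. -/
def SuppD (D : Set K) (W : K) : Prop :=
  ∀ u < W, ∀ c < W, NMemD D (pair u c) W ∨ Clause D (fun u c => MemD D (pair u c) W) u c

/-- The code `u` is true at the assignment `c`. -/
def PhiD (D : Set K) (u c : K) : Prop := ∃ W ∈ D, SuppD D W ∧ MemD D (pair u c) W

/-- The code `u` is true at the assignment `{⟨0, c⟩}`. -/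
def PsiD (D : Set K) (u c : K) : Prop := ∃ p ∈ D, ExpD D (pair 0 c) p ∧ PhiD D u p

end Relativized

/-! ### The corresponding formulas -/

section Formulas

variable {C : Type*}

namespace Fm

open Tm

/-- The pairing term. -/
def _root_.ArithModel.Tm.pair (s t : Tm C) : Tm C := add (mul (add s t) (add s t)) s

/-- The formula for `BetaD`. -/
def beta (s t i v : Tm C) : Fm C :=
  and (lt v (add Tm.one (mul (add i Tm.one) t)))
    (ex (eq s.lift (add (mul (var 0) (add Tm.one (mul (add i.lift Tm.one) t.lift))) v.lift)))

/-- The formula for `ExpD`. -/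
def exp (x y : Tm C) : Fm C :=
  ex (ex (and (beta (var 1) (var 0) zero Tm.one) (and
    (ball x.lift.lift (ex (and (beta (var 3) (var 2) (var 1) (var 0))
      (beta (var 3) (var 2) (add (var 1) Tm.one) (add (var 0) (var 0))))))
    (beta (var 1) (var 0) x.lift.lift y.lift.lift))))

/-- The formula for `MemD`. -/
def mem (x y : Tm C) : Fm C :=
  ex (and (exp x.lift (var 0)) (ex (ex (and (lt (var 0) (var 2))
    (eq y.lift.lift.lift (add (mul (add (add (var 1) (var 1)) Tm.one) (var 2)) (var 0)))))))

/-- The formula for `NMemD`. -/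
def nmem (x y : Tm C) : Fm C :=
  ex (and (exp x.lift (var 0)) (ex (ex (and (lt (var 0) (var 2))
    (eq y.lift.lift.lift (add (mul (add (var 1) (var 1)) (var 2)) (var 0)))))))

/-- The first disjunct of `Clause`, at variables `c`, `u`. -/
def clauseAtom : Fm C :=
  ex <| ex <| ex <| ex <| ex <| and
    (eq (var 6) (Tm.pair zero (Tm.pair (Tm.pair (var 4) (var 3))
      (Tm.pair (Tm.pair (var 2) (var 1)) (var 0)))))
    (ex <| ex <| ex <| ex <| and (mem (Tm.pair (var 8) (var 3)) (var 9)) <|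
      and (mem (Tm.pair (var 7) (var 2)) (var 9)) <|
      and (mem (Tm.pair (var 6) (var 1)) (var 9)) <|
      and (mem (Tm.pair (var 5) (var 0)) (var 9)) <|
      eq (add (mul (var 3) (var 2)) (var 1)) (add (var 0) (var 4)))

/-- The second disjunct of `Clause`, at variables `c`, `u`, `W`. -/
def clauseEx : Fm C :=
  ex <| ex <| and (eq (var 3) (Tm.pair Tm.one (Tm.pair (var 1) (var 0)))) <|
    ex <| ex <| and (exp (Tm.pair (var 3) (var 1)) (var 0)) <| ball (var 2) <|
      or (nmem (var 0) (var 3)) (mem (Tm.pair (var 0) (add (var 5) (var 1))) (var 7))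

/-- The third disjunct of `Clause`, at variables `c`, `u`, `W`. -/
def clauseAll : Fm C :=
  ex <| ex <| ex <| and
    (eq (var 4) (Tm.pair (add Tm.one Tm.one) (Tm.pair (Tm.pair (var 2) (var 1)) (var 0)))) <|
    ex <| and (mem (Tm.pair (var 2) (var 0)) (var 4)) <| ball (var 0) <| ex <|
      and (exp (Tm.pair (var 5) (var 1)) (var 0)) <| bex (var 3) <|
      and (mem (var 0) (var 4)) (mem (Tm.pair (var 0) (add (var 7) (var 1))) (var 9))

/-- The formula for `PhiD`, at variables `c`, `u`. -/
def phi : Fm C :=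
  ex <| and (ball (var 0) <| ball (var 1) <| or (nmem (Tm.pair (var 1) (var 0)) (var 2)) <|
    or clauseAtom (or clauseEx clauseAll)) (mem (Tm.pair (var 2) (var 1)) (var 0))

/-- The formula for `PsiD`, at variables `u`, `c`. -/
def psi : Fm C := ex <| and (exp (Tm.pair zero (var 2)) (var 0)) phi

/-- The formula for `MemD`, at a variable that codes a pair. -/
def memPair : Fm C := ex <| ex <| and (eq (var 2) (Tm.pair (var 1) (var 0))) (mem (var 1) (var 0))

/-- The formula for `NMemD`, at a variable that codes a pair. -/
def nmemPair : Fm C :=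
  ex <| ex <| and (eq (var 2) (Tm.pair (var 1) (var 0))) (nmem (var 1) (var 0))

variable {K : Type*} [ArithStructure K] (D : Set K) (κ : C → K) (ρ : ℕ → K)

/-- The de Bruijn indices are arranged so that evaluation unfolds definitionally to the relativized
predicates. -/
theorem eval_psi : (psi : Fm C).eval D κ ρ ↔ PsiD D (ρ 0) (ρ 1) := Iff.rfl

theorem eval_memPair : (memPair : Fm C).eval D κ ρ ↔
    ∃ x ∈ D, ∃ y ∈ D, ρ 0 = ArithModel.pair x y ∧ MemD D x y := Iff.rfl

theorem eval_nmemPair : (nmemPair : Fm C).eval D κ ρ ↔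
    ∃ x ∈ D, ∃ y ∈ D, ρ 0 = ArithModel.pair x y ∧ NMemD D x y := Iff.rfl

end Fm

end Formulas

/-! ### Definability and evaluation -/

section Definability

variable {K : Type*} [ArithStructure K]

/-- Only the two kinds of domain named in the `Fact` are used; membership in them is trivial or a
single inequality. -/
instance S1.memD {D : Set K} [hD : Fact (D = Set.univ ∨ ∃ b, D = below b)]
    {x : (ℕ → K) → K} [IsTm x] : S1 (fun ρ => x ρ ∈ D) := by
  rcases hD.out with rfl | ⟨b, rfl⟩
  · exact S1.congr (P := fun _ => (0 : K) = 0) inferInstance (by simp)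
  · infer_instance

instance {b : K} : Fact (below b = Set.univ ∨ ∃ b', below b = below b') := ⟨.inr ⟨b, rfl⟩⟩

instance : Fact ((Set.univ : Set K) = Set.univ ∨ ∃ b, (Set.univ : Set K) = below b) := ⟨.inl rfl⟩

variable {D : Set K} [hD : Fact (D = Set.univ ∨ ∃ b, D = below b)] {x y : (ℕ → K) → K}
  [IsTm x] [IsTm y]

instance S1.betaD {s t : (ℕ → K) → K} [IsTm s] [IsTm t] :
    S1 (fun ρ => BetaD D (s ρ) (t ρ) (x ρ) (y ρ)) := by
  unfold BetaD
  infer_instance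

instance S1.expD : S1 (fun ρ => ExpD D (x ρ) (y ρ)) := by
  unfold ExpD
  infer_instance

instance S1.membD : S1 (fun ρ => MemD D (x ρ) (y ρ)) := by
  unfold MemD
  infer_instance

instance S1.nmemD : S1 (fun ρ => NMemD D (x ρ) (y ρ)) := by
  unfold NMemD
  infer_instance

set_option synthInstance.maxHeartbeats 400000 in
set_option synthInstance.maxSize 2000 in
instance S1.clauseMem {w : (ℕ → K) → K} [IsTm w] [Fact (ModelsISigma1 K)] :
    S1 (fun ρ => Clause D (fun u c => MemD D (pair u c) (w ρ)) (x ρ) (y ρ)) := by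
  unfold Clause
  beta_reduce
  infer_instance

instance S1.suppD [Fact (ModelsISigma1 K)] : S1 (fun ρ => SuppD D (x ρ)) := by
  unfold SuppD
  infer_instance

instance S1.phiD [Fact (ModelsISigma1 K)] : S1 (fun ρ => PhiD D (x ρ) (y ρ)) := by
  unfold PhiD
  infer_instance

instance S1.psiD [Fact (ModelsISigma1 K)] : S1 (fun ρ => PsiD D (x ρ) (y ρ)) := by
  unfold PsiD
  infer_instance

end Definability

/-! ### Truth clauses for game formulas, and codes of assignments -/

section Truth

variable {K : Type*} [ArithStructure K] [hK : Fact (ModelsISigma1 K)] {D : Set K}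

theorem SuppD.clause {W u c : K} (hW : SuppD D W) (h : AckMem (pair u c) W) :
    Clause D (fun u c => MemD D (pair u c) W) u c :=
  (hW u ((le_pair_left u c).trans_lt h.lt) c ((le_pair_right u c).trans_lt h.lt)).resolve_left
    fun h' => ackNMem_iff.1 h'.nmem h

/-- A union of self-supporting sets is self-supporting. This works for every `D`, in particular
below `b` in `N`, where no closure properties are available. -/
theorem PhiD.clause {u c : K} : PhiD D u c → Clause D (PhiD D) u c := by
  rintro ⟨W, hWD, hW, h⟩
  exact (hW.clause h.mem).mono fun u c h => ⟨W, hWD, hW, h⟩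

/-- The justifications in a step of the evaluation can be chosen below a common bound. -/
theorem Clause.exists_bound {u c : K} (h : Clause Set.univ (PhiD Set.univ) u c) :
    ∃ B, Clause Set.univ
      (fun u c => ∃ W < B, SuppD Set.univ W ∧ MemD Set.univ (pair u c) W) u c := by
  rcases h with h1 | ⟨k, hk, a, ha, hu, x, hx, p, hp, he, h1⟩ |
    ⟨k, hk, l, hl, a, ha, hu, y, hy, hm, h1⟩
  · exact ⟨0, .inl h1⟩
  · obtain ⟨B, hB⟩ := sigma1_collection (fun v W => NMemD Set.univ v a ∨
      SuppD Set.univ W ∧ MemD Set.univ (pair v (c + p)) W) a fun v hv => by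
        rcases h1 v hv with h | ⟨W, -, h⟩
        · exact ⟨0, .inl h⟩
        · exact ⟨W, .inr h⟩
    refine ⟨B, .inr (.inl ⟨k, hk, a, ha, hu, x, hx, p, hp, he, fun v hv => ?_⟩)⟩
    obtain ⟨W, hW, h | h⟩ := hB v hv
    · exact .inl h
    · exact .inr ⟨W, hW, h⟩
  · obtain ⟨B, hB⟩ := sigma1_collection (fun x W => ∃ p, ExpD Set.univ (pair k x) p ∧
      ∃ v < a, MemD Set.univ v a ∧ SuppD Set.univ W ∧ MemD Set.univ (pair v (c + p)) W) y
      fun x hx => by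
        obtain ⟨p, -, he, v, hv, hva, W, -, h⟩ := h1 x hx
        exact ⟨W, p, he, v, hv, hva, h⟩
    refine ⟨B, .inr (.inr ⟨k, hk, l, hl, a, ha, hu, y, hy, hm, fun x hx => ?_⟩)⟩
    obtain ⟨W, hW, p, he, v, hv, hva, h⟩ := hB x hx
    exact ⟨p, trivial, he, v, hv, hva, W, hW, h⟩

/-- Collection bounds the sets that support the premises by some `B`, and Σ₁-comprehension merges
all self-supporting sets below `B`, together with the new pair, into one. This needs `D = univ`. -/
theorem phiD_of_clause {u c : K} (h : Clause Set.univ (PhiD Set.univ) u c) :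
    PhiD Set.univ u c := by
  obtain ⟨B, hB⟩ := h.exists_bound
  obtain ⟨W, hW⟩ := exists_code (fun j => j = pair u c ∨
    ∃ W < B, SuppD Set.univ W ∧ MemD Set.univ j W) (B + (pair u c + 1))
  have hmono : ∀ j, (∃ W < B, SuppD Set.univ W ∧ MemD Set.univ j W) → MemD Set.univ j W := by
    rintro j ⟨W', hW', h⟩
    exact memD_univ.2 ((hW j).2 ⟨h.2.mem.lt.trans (hW'.trans_le le_self_add), .inr ⟨W', hW', h⟩⟩)
  refine ⟨W, trivial, fun u' _ c' _ => ?_, memD_univ.2 ((hW _).2 ⟨?_, .inl rfl⟩)⟩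
  · by_cases h' : AckMem (pair u' c') W
    · refine .inr ?_
      rcases ((hW _).1 h').2 with h | ⟨W', hW', hS, h⟩
      · obtain ⟨rfl, rfl⟩ := pair_inj.1 h
        exact hB.mono fun _ _ => hmono _
      · exact (hS.clause h.mem).mono fun _ _ h => hmono _ ⟨W', hW', hS, h⟩
    · exact .inl (nmemD_univ.2 (ackNMem_iff.2 h'))
  · exact (lt_add_one _).trans_le le_add_self

theorem zero_ne_one_code : (0 : K) ≠ one K := zero_ne_one
theorem zero_ne_two_code : (0 : K) ≠ one K + one K := by
  rw [one_eq]; exact (by positivity : (1 : K) + 1 ≠ 0).symm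
theorem one_ne_two_code : one K ≠ one K + one K := (lt_add_one (1 : K)).ne

/-- The code of the atomic formula `xₚ x_q + xᵣ = xₛ + i`. -/
def atomCode {M : Type*} [ArithStructure M] (p q r s i : M) : M :=
  pair 0 (pair (pair p q) (pair (pair r s) i))

/-- The code of the formula `∃ xₖ ⋀ h`. -/
def exCode {M : Type*} [ArithStructure M] (k h : M) : M := pair (one M) (pair k h)

/-- The code of the formula `∀ xₖ < xₗ ⋁ h`. -/
def allCode {M : Type*} [ArithStructure M] (k l h : M) : M :=
  pair (one M + one M) (pair (pair k l) h)

theorem phiD_atomCode {p q r s i x y z w c : K} (hx : AckMem (pair p x) c)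
    (hy : AckMem (pair q y) c) (hz : AckMem (pair r z) c) (hw : AckMem (pair s w) c)
    (h : x * y + z = w + i) : PhiD Set.univ (atomCode p q r s i) c := by
  refine phiD_of_clause (.inl ⟨p, trivial, q, trivial, r, trivial, s, trivial, i, trivial, rfl,
    x, trivial, y, trivial, z, trivial, w, trivial, ?_⟩)
  simp only [memD_univ]
  exact ⟨hx, hy, hz, hw, h⟩

/-- The conclusion `x ∈ D` is what later forces all values of the embedding below `b`. -/
theorem PhiD.atomCode {p q r s i c : K} (h : PhiD D (atomCode p q r s i) c) :
    ∃ x ∈ D, ∃ y ∈ D, ∃ z ∈ D, ∃ w ∈ D, AckMem (pair p x) c ∧ AckMem (pair q y) c ∧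
      AckMem (pair r z) c ∧ AckMem (pair s w) c ∧ x * y + z = w + i := by
  rcases h.clause with ⟨p', -, q', -, r', -, s', -, i', -, hu, h⟩ | ⟨_, -, _, -, hu, -⟩ |
    ⟨_, -, _, -, _, -, hu, -⟩
  · simp only [ArithModel.atomCode, pair_inj, true_and] at hu
    obtain ⟨⟨rfl, rfl⟩, ⟨rfl, rfl⟩, rfl⟩ := hu
    obtain ⟨x, hx, y, hy, z, hz, w, hw, h1, h2, h3, h4, h⟩ := h
    exact ⟨x, hx, y, hy, z, hz, w, hw, h1.mem, h2.mem, h3.mem, h4.mem, h⟩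
  · exact absurd (pair_inj.1 hu).1 zero_ne_one_code
  · exact absurd (pair_inj.1 hu).1 zero_ne_two_code

theorem phiD_exCode {k h c x : K}
    (H : ∀ v, AckMem v h → PhiD Set.univ v (c + pow2 (pair k x))) :
    PhiD Set.univ (exCode k h) c := by
  refine phiD_of_clause (.inr (.inl ⟨k, trivial, h, trivial, rfl, x, trivial, _, trivial,
    expD_univ.2 (exp_pow2 _), fun v _ => ?_⟩))
  rw [nmemD_univ, ackNMem_iff]
  exact (em (AckMem v h)).symm.imp_right (H v)

theorem PhiD.exCode {k h c : K} (H : PhiD D (exCode k h) c) :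
    ∃ x ∈ D, ∀ v, AckMem v h → PhiD D v (c + pow2 (pair k x)) := by
  rcases H.clause with ⟨_, -, _, -, _, -, _, -, _, -, hu, -⟩ | ⟨k', -, h', -, hu, H⟩ |
    ⟨_, -, _, -, _, -, hu, -⟩
  · exact absurd (pair_inj.1 hu).1 zero_ne_one_code.symm
  · simp only [ArithModel.exCode, pair_inj, true_and] at hu
    obtain ⟨rfl, rfl⟩ := hu
    obtain ⟨x, hx, p, -, hp, H⟩ := H
    obtain rfl := exp_iff.1 hp.exp
    exact ⟨x, hx, fun v hv =>
      (H v hv.lt).resolve_left fun h' => ackNMem_iff.1 h'.nmem hv⟩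
  · exact absurd (pair_inj.1 hu).1 one_ne_two_code

theorem phiD_allCode {k l h c y : K} (hy : AckMem (pair l y) c)
    (H : ∀ x < y, ∃ v, AckMem v h ∧ PhiD Set.univ v (c + pow2 (pair k x))) :
    PhiD Set.univ (allCode k l h) c := by
  refine phiD_of_clause (.inr (.inr ⟨k, trivial, l, trivial, h, trivial, rfl, y, trivial,
    memD_univ.2 hy, fun x hx => ?_⟩))
  obtain ⟨v, hv, hv'⟩ := H x hx
  exact ⟨_, trivial, expD_univ.2 (exp_pow2 _), v, hv.lt, memD_univ.2 hv, hv'⟩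

theorem PhiD.allCode {k l h c : K} (H : PhiD D (allCode k l h) c) :
    ∃ y, AckMem (pair l y) c ∧
      ∀ x < y, ∃ v, AckMem v h ∧ PhiD D v (c + pow2 (pair k x)) := by
  rcases H.clause with ⟨_, -, _, -, _, -, _, -, _, -, hu, -⟩ | ⟨_, -, _, -, hu, -⟩ |
    ⟨k', -, l', -, h', -, hu, H⟩
  · exact absurd (pair_inj.1 hu).1 zero_ne_two_code.symm
  · exact absurd (pair_inj.1 hu).1 one_ne_two_code.symm
  · simp only [ArithModel.allCode, pair_inj, true_and] at hu
    obtain ⟨⟨rfl, rfl⟩, rfl⟩ := hu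
    obtain ⟨y, -, hy, H⟩ := H
    refine ⟨y, hy.mem, fun x hx => ?_⟩
    obtain ⟨p, -, hp, v, -, hv, hv'⟩ := H x hx
    rw [← exp_iff.1 hp.exp]
    exact ⟨v, hv.mem, hv'⟩

/-! ### Codes of finite sequences -/

/-- `c` codes the list `l` as a set of pairs. -/
def CodesList (c : K) (l : List K) : Prop :=
  ∀ j, AckMem j c ↔ ∃ (k : ℕ) (x : K), l[k]? = some x ∧ j = pair (k : K) x

theorem codesList_nil : CodesList (0 : K) [] := fun j => by simp [not_ackMem_zero]

theorem CodesList.ackMem_pair {c : K} {l : List K} (h : CodesList c l) {k : ℕ} {x : K} :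
    AckMem (pair (k : K) x) c ↔ l[k]? = some x := by
  rw [h]
  simp only [pair_inj, Nat.cast_inj]
  constructor
  · rintro ⟨k, x, h, rfl, rfl⟩
    exact h
  · exact fun h => ⟨k, x, h, rfl, rfl⟩

theorem CodesList.append {c : K} {l : List K} (h : CodesList c l) (x : K) :
    CodesList (c + pow2 (pair (l.length : K) x)) (l ++ [x]) := by
  intro j
  rw [ackMem_add_pow2 (by simp [h.ackMem_pair]), h]
  constructor
  · rintro (⟨k, y, hk, rfl⟩ | rfl)
    · refine ⟨k, y, ?_, rfl⟩
      rw [List.getElem?_append_left (List.getElem?_eq_some_iff.1 hk).1, hk]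
    · exact ⟨l.length, x, by simp, rfl⟩
  · rintro ⟨k, y, hk, rfl⟩
    rcases lt_or_ge k l.length with hl | hl
    · rw [List.getElem?_append_left hl] at hk
      exact .inl ⟨k, y, hk, rfl⟩
    · rw [List.getElem?_append_right hl, List.getElem?_singleton] at hk
      split_ifs at hk with h0
      rw [show k = l.length by omega, Option.some_inj.1 hk]
      exact .inr rfl

end Truth

/-! ### Embeddings -/

section Embedding

variable {I M : Type*} [ArithStructure I] [ArithStructure M] (e : I ↪[LA] M)

theorem emb_zero : e 0 = 0 := by
  have := e.map_fun (ArithFunc.zero : LA.Functions 0) ![]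
  exact this

theorem emb_succ (x : I) : e (ArithStructure.succ x) = ArithStructure.succ (e x) :=
  e.map_fun (ArithFunc.succ : LA.Functions 1) ![x]

theorem emb_add (x y : I) : e (x + y) = e x + e y :=
  e.map_fun (ArithFunc.add : LA.Functions 2) ![x, y]

theorem emb_mul (x y : I) : e (x * y) = e x * e y :=
  e.map_fun (ArithFunc.mul : LA.Functions 2) ![x, y]

theorem emb_lt {x y : I} : e x < e y ↔ x < y :=
  e.map_rel (ArithRel.lt : LA.Relations 2) ![x, y]

theorem emb_one : e (one I) = one M := by rw [one, emb_succ, emb_zero]; rfl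

theorem emb_pair (x y : I) : e (pair x y) = pair (e x) (e y) := by
  simp only [pair, emb_add, emb_mul]

theorem emb_exCode (k h : I) : e (exCode k h) = exCode (e k) (e h) := by
  simp only [exCode, emb_pair, emb_one]

theorem emb_allCode (k l h : I) : e (allCode k l h) = allCode (e k) (e l) (e h) := by
  simp only [allCode, emb_pair, emb_one, emb_add]

theorem emb_atomCode (p q r s i : I) :
    e (atomCode p q r s i) = atomCode (e p) (e q) (e r) (e s) (e i) := by
  simp only [atomCode, emb_pair, emb_zero]

theorem emb_numeral [Fact (ModelsISigma1 M)] (k : ℕ) : e (numeral I k) = (k : M) := by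
  induction k with
  | zero => rw [numeral, emb_zero, Nat.cast_zero]
  | succ k ih => rw [numeral, emb_succ, ih, succ_eq, Nat.cast_succ]

variable {e}

theorem IsInitialSegment.lt_of_notMem [Fact (ModelsISigma1 M)] {J : Set M}
    (hJ : IsInitialSegment J) {x n : M} (hx : x ∈ J) (hn : n ∉ J) : x < n := by
  by_contra! h
  rcases h.lt_or_eq with h | rfl
  · exact hn (hJ x hx n h)
  · exact hn hx

theorem IsProperExpCut.exists_notMem (he : IsProperExpCut e) : ∃ n, n ∉ Set.range e :=
  (Set.ne_univ_iff_exists_notMem _).1 he.isProperCut.proper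

theorem zero_mem_range : (0 : M) ∈ Set.range e := ⟨0, emb_zero e⟩

variable [Fact (ModelsISigma1 M)]

theorem IsProperExpCut.lt (he : IsProperExpCut e) {n : M} (hn : n ∉ Set.range e) (i : I) :
    e i < n := he.isProperCut.initial.lt_of_notMem ⟨i, rfl⟩ hn

theorem add_one_mem_range : ∀ x ∈ Set.range e, x + 1 ∈ Set.range e := by
  rintro _ ⟨i, rfl⟩
  exact ⟨ArithStructure.succ i, by rw [emb_succ, succ_eq]⟩

/-- Truncations of sets at elements of an exponentially closed cut are coded in the cut. -/
theorem IsProperExpCut.exists_trunc (he : IsProperExpCut e) (h : M) (t : I) :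
    ∃ g : I, ∀ j, AckMem j (e g) ↔ j < e t ∧ AckMem j h := by
  obtain ⟨r, hr, hr'⟩ := exists_mod_pow2 h (e t)
  obtain ⟨y, hy, hy'⟩ := he.closedUnderExp (e t) ⟨t, rfl⟩
  rw [exp_iff] at hy'
  obtain ⟨g, rfl⟩ := he.isProperCut.initial y hy r (hy' ▸ hr)
  exact ⟨g, hr'⟩

end Embedding

/-! ### The back-and-forth steps -/

section BackAndForth

variable {I M N : Type*} [ArithStructure I] [ArithStructure M] [ArithStructure N]
  [Fact (ModelsISigma1 M)] [Fact (ModelsISigma1 N)] {eM : I ↪[LA] M} {eN : I ↪[LA] N}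

/-- The codes from the cut true at `c` in `M` are true at `a` in `N` below `b`. -/
def Transfers (eM : I ↪[LA] M) (eN : I ↪[LA] N) (b : N) (c : M) (a : N) : Prop :=
  ∀ u : I, PhiD Set.univ (eM u) c → PhiD (below b) (eN u) a

/-- `h` codes the true game formulas, up to some `n` above the cut, of the assignment extended by
`m`. Each truncation of `h` in the cut is realized in `N` through an `exCode`; overspill realizes
all of them at once. -/
theorem Transfers.forth {b : N} {c : M} {a : N} (hP : Transfers eM eN b c a)
    (hM : IsProperExpCut eM) (hN : IsProperExpCut eN) (hS : SSy eM ⊆ SSy eN)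
    (hE : ∀ v h : I, AckMem (eM v) (eM h) ↔ AckMem (eN v) (eN h)) (k : I) (m : M) :
    ∃ x : N, Transfers eM eN b (c + pow2 (pair (eM k) m)) (a + pow2 (pair (eN k) x)) := by
  obtain ⟨n, hn⟩ := hM.exists_notMem
  obtain ⟨h, hh⟩ := exists_code (fun u => PhiD Set.univ u (c + pow2 (pair (eM k) m))) n
  obtain ⟨h', hh'⟩ := hS ⟨h, rfl⟩
  replace hh' : ∀ i, AckMem (eM i) h ↔ AckMem (eN i) h' := fun i => Set.ext_iff.1 hh' i
  -- A `t` outside the cut lies above all codes from `I`, so the single `x` found for it respects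
  -- every one of them.
  obtain ⟨t, ht, x, p, hp, hx⟩ := sigma1_overspill (fun t => ∃ x p, Exp (pair (eN k) x) p ∧
    ∀ v < t, AckNMem v h' ∨ PhiD (below b) v (a + p)) zero_mem_range add_one_mem_range
    hN.isProperCut.proper (by
      rintro _ ⟨t, rfl⟩
      obtain ⟨g, hg⟩ := hM.exists_trunc h t
      have hu : PhiD Set.univ (eM (exCode k g)) c := by
        rw [emb_exCode]
        exact phiD_exCode fun v hv => ((hh v).1 ((hg v).1 hv).2).2
      have hu' := hP _ hu
      rw [emb_exCode] at hu'
      obtain ⟨x, -, hx⟩ := hu'.exCode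
      refine ⟨x, _, exp_pow2 _, fun v hv => ?_⟩
      obtain ⟨v, rfl⟩ := hN.isProperCut.initial _ ⟨t, rfl⟩ v hv
      rw [ackNMem_iff, ← hh']
      by_cases hvh : AckMem (eM v) h
      · exact .inr (hx _ ((hE _ _).1 ((hg _).2 ⟨(emb_lt eM).2 ((emb_lt eN).1 hv), hvh⟩)))
      · exact .inl hvh)
  refine ⟨x, fun u hu => ?_⟩
  rw [exp_iff] at hp
  rw [← hp]
  refine (hx _ (hN.lt ht u)).resolve_left fun h1 => ?_
  rw [ackNMem_iff, ← hh', hh] at h1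
  exact h1 ⟨hM.lt hn u, hu⟩

/-- Dual to `Transfers.forth`: `h` has the same trace on the cut as the set of codes false in `N` at
`x'`. If, for some truncation of `h`, each `x < y` made a member true, an `allCode` true in `M`
would transfer and make a false code true at `x'`. -/
theorem Transfers.back {b : N} {c : M} {a : N} (hP : Transfers eM eN b c a)
    (hM : IsProperExpCut eM) (hN : IsProperExpCut eN) (hS : SSy eN ⊆ SSy eM)
    (hE : ∀ v h : I, AckMem (eM v) (eM h) ↔ AckMem (eN v) (eN h)) (k l : I) {y : M} {y' : N}
    (hy : AckMem (pair (eM l) y) c) (hy' : ∀ z, AckMem (pair (eN l) z) a → z = y')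
    {x' : N} (hx' : x' < y') :
    ∃ x : M, Transfers eM eN b (c + pow2 (pair (eM k) x)) (a + pow2 (pair (eN k) x')) := by
  obtain ⟨n, hn⟩ := hN.exists_notMem
  obtain ⟨g', hg'⟩ := exists_code
    (fun u => PhiD (below b) u (a + pow2 (pair (eN k) x'))) n
  obtain ⟨h', hh'⟩ := exists_code (fun u => AckNMem u g') n
  simp only [ackNMem_iff, hg'] at hh'
  obtain ⟨h, hh⟩ := hS ⟨h', rfl⟩
  replace hh : ∀ i, AckMem (eN i) h' ↔ AckMem (eM i) h := fun i => Set.ext_iff.1 hh i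
  -- The negation says that each `x < y` makes some code in `h` below `ρ 0` true. This is Σ₁ once
  -- `pow2` is replaced by its graph.
  have hR : S1 (fun ρ : ℕ → M => ¬ ∃ x < y, ∀ v < ρ 0, AckMem v h →
      ¬ PhiD Set.univ v (c + pow2 (pair (eM k) x))) := by
    refine S1.congr (P := fun ρ => ∀ x < y, ∃ v < ρ 0, AckMem v h ∧
      ∃ p, Exp (pair (eM k) x) p ∧ PhiD Set.univ v (c + p)) inferInstance fun ρ => ?_
    simp only [exp_iff, exists_eq_left]
    push Not
    rfl
  obtain ⟨t, ht, x, hx, H⟩ := pi1_overspill (fun t => ∃ x < y, ∀ v < t, AckMem v h →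
      ¬ PhiD Set.univ v (c + pow2 (pair (eM k) x))) zero_mem_range add_one_mem_range
    hM.isProperCut.proper (by
      rintro _ ⟨t, rfl⟩
      by_contra! H
      obtain ⟨g, hg⟩ := hM.exists_trunc h t
      have hu : PhiD Set.univ (eM (allCode k l g)) c := by
        rw [emb_allCode]
        refine phiD_allCode hy fun x hx => ?_
        obtain ⟨v, hv, hvh, hv'⟩ := H x hx
        exact ⟨v, (hg v).2 ⟨hv, hvh⟩, hv'⟩
      have hu' := hP _ hu
      rw [emb_allCode] at hu'
      obtain ⟨z, hz, H'⟩ := hu'.allCode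
      obtain rfl := hy' z hz
      obtain ⟨v, hv, hv'⟩ := H' x' hx'
      obtain ⟨v, rfl⟩ := hN.isProperCut.initial _ ⟨g, rfl⟩ v hv.lt
      rw [← hE, hg, ← hh, hh'] at hv
      exact hv.2.2 ⟨hN.lt hn v, hv'⟩)
  refine ⟨x, fun u hu => ?_⟩
  by_contra h1
  refine H (eM u) (hM.lt ht u) ?_ hu
  rw [← hh, hh']
  exact ⟨hN.lt hn u, fun h2 => h1 h2.2⟩

end BackAndForth

/-- A relation between finite sequences with the forth property, and the back property for
elements allowed by `A`, extends to an infinite sequence. -/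
theorem exists_back_and_forth {M N : Type*} [Countable M] [Countable N]
    (Q : List (M × N) → Prop) (A : N → N → Prop) (l₀ : List (M × N)) (h₀ : Q l₀)
    (forth : ∀ l, Q l → ∀ m, ∃ a, Q (l ++ [(m, a)]))
    (back : ∀ l, Q l → ∀ p ∈ l, ∀ a, A a p.2 → ∃ m, Q (l ++ [(m, a)])) :
    ∃ L : ℕ → List (M × N), (∀ n, Q (L n)) ∧ L 0 = l₀ ∧ (∀ n n', n ≤ n' → L n ⊆ L n') ∧
      (∀ m, ∃ n a, (m, a) ∈ L n) ∧
      ∀ n, ∀ p ∈ L n, ∀ a, A a p.2 → ∃ n' m, (m, a) ∈ L n' := by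
  rcases isEmpty_or_nonempty (M ⊕ N) with hE | hE
  · rw [isEmpty_sum] at hE
    obtain ⟨hM, hN⟩ := hE
    exact ⟨fun _ => l₀, fun _ => h₀, rfl, fun _ _ _ _ h => h, fun m => isEmptyElim m,
      fun _ p => isEmptyElim p.1⟩
  -- The factor `ℕ` makes every request recur infinitely often, so a back request comes up again
  -- after an element that allows it has entered the list.
  obtain ⟨g, hg⟩ := exists_surjective_nat ((M ⊕ N) × ℕ)
  have step : ∀ (l : {l // Q l}) (s : M ⊕ N), ∃ l' : {l // Q l}, l.1 ⊆ l'.1 ∧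
      (∀ m, s = .inl m → ∃ a, (m, a) ∈ l'.1) ∧
      ∀ a, s = .inr a → (∃ p ∈ l.1, A a p.2) → ∃ m, (m, a) ∈ l'.1 := by
    rintro ⟨l, hl⟩ (m | a)
    · obtain ⟨a, ha⟩ := forth l hl m
      exact ⟨⟨_, ha⟩, by simp, by rintro _ ⟨⟩; exact ⟨a, by simp⟩, by simp⟩
    · by_cases h : ∃ p ∈ l, A a p.2
      · obtain ⟨p, hp, hp'⟩ := h
        obtain ⟨m, hm⟩ := back l hl p hp a hp'
        exact ⟨⟨_, hm⟩, by simp, by simp, by rintro _ ⟨⟩ -; exact ⟨m, by simp⟩⟩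
      · exact ⟨⟨l, hl⟩, by simp, by simp, by rintro _ ⟨⟩ h'; exact absurd h' h⟩
  choose F hF1 hF2 hF3 using step
  let L : ℕ → {l // Q l} := fun n => Nat.rec ⟨l₀, h₀⟩ (fun n l => F l (g n).1) n
  have hmono : ∀ n n', n ≤ n' → (L n).1 ⊆ (L n').1 := by
    intro n n' h
    induction h with
    | refl => exact fun _ h => h
    | step _ ih => exact fun x hx => hF1 _ _ (ih hx)
  refine ⟨fun n => (L n).1, fun n => (L n).2, rfl, hmono, fun m => ?_, fun n p hp a ha => ?_⟩
  · obtain ⟨n, hn⟩ := hg (.inl m, 0)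
    obtain ⟨a, ha⟩ := hF2 (L n) (g n).1 m (by rw [hn])
    exact ⟨n + 1, a, ha⟩
  · obtain ⟨k, hk, hk'⟩ : ∃ k, n ≤ k ∧ (g k).1 = .inr a := by
      have hinf : Set.Infinite {k | (g k).1 = Sum.inr a} := by
        intro hfin
        have : (Set.range fun j : ℕ => ((Sum.inr a : M ⊕ N), j)) ⊆
            g '' {k | (g k).1 = Sum.inr a} := by
          rintro _ ⟨j, rfl⟩
          obtain ⟨k, hk⟩ := hg (.inr a, j)
          exact ⟨k, by simp [hk], hk⟩
        refine Set.infinite_range_of_injective ?_ ((hfin.image g).subset this)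
        intro i j h
        simpa using h
      obtain ⟨k, hk, hk'⟩ := hinf.exists_gt n
      exact ⟨k, hk'.le, hk⟩
    obtain ⟨m, hm⟩ := hF3 (L k) (g k).1 a hk' ⟨p, hmono n k hk hp, ha⟩
    exact ⟨k + 1, m, hm⟩

/-! ### Construction of the embedding -/

section Construction

variable {I M N : Type*} [ArithStructure I] [ArithStructure M] [ArithStructure N]
  [Fact (ModelsISigma1 M)] [Fact (ModelsISigma1 N)] {eM : I ↪[LA] M} {eN : I ↪[LA] N}

/-- The list of pairs is a partial map that preserves the truth of codes. -/
def PartialTransfer (eM : I ↪[LA] M) (eN : I ↪[LA] N) (b : N) (l : List (M × N)) : Prop :=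
  ∃ c a, CodesList c (l.map Prod.fst) ∧ CodesList a (l.map Prod.snd) ∧ Transfers eM eN b c a

theorem PartialTransfer.atom {b : N} {l : List (M × N)} (h : PartialTransfer eM eN b l)
    {p q r s : M × N} (hp : p ∈ l) (hq : q ∈ l) (hr : r ∈ l) (hs : s ∈ l) {i : I}
    (H : p.1 * q.1 + r.1 = s.1 + eM i) : p.2 * q.2 + r.2 = s.2 + eN i ∧ p.2 < b := by
  obtain ⟨c, a, hc, ha, hP⟩ := h
  obtain ⟨kp, hp⟩ := List.mem_iff_getElem?.1 hp
  obtain ⟨kq, hq⟩ := List.mem_iff_getElem?.1 hq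
  obtain ⟨kr, hr⟩ := List.mem_iff_getElem?.1 hr
  obtain ⟨ks, hs⟩ := List.mem_iff_getElem?.1 hs
  have hM : ∀ {k : ℕ} {p : M × N}, l[k]? = some p → AckMem (pair (k : M) p.1) c := by
    intro k p h
    rw [hc.ackMem_pair, List.getElem?_map, h]
    rfl
  have hN : ∀ {k : ℕ} {p : M × N} {x : N}, l[k]? = some p → AckMem (pair (k : N) x) a →
      p.2 = x := by
    intro k p x h h'
    rw [ha.ackMem_pair, List.getElem?_map, h] at h'
    exact Option.some_inj.1 h'
  have := hP (atomCode (numeral I kp) (numeral I kq) (numeral I kr) (numeral I ks) i) (by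
    simp only [emb_atomCode, emb_numeral]
    exact phiD_atomCode (hM hp) (hM hq) (hM hr) (hM hs) H)
  simp only [emb_atomCode, emb_numeral] at this
  obtain ⟨x, hx, y, -, z, -, w, -, h1, h2, h3, h4, h⟩ := this.atomCode
  rw [hN hp h1, hN hq h2, hN hr h3, hN hs h4]
  exact ⟨h, hx⟩

/-- The common core of both parts: `hPsi` starts the back-and-forth at the pair `(c, a)`, and the
union of the resulting finite lists is the graph of `j`. -/
theorem exists_properInitial [Countable M] [Countable N] (hM : IsProperExpCut eM)
    (hN : IsProperExpCut eN) (hS : SSy eM = SSy eN)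
    (hE : ∀ v h : I, AckMem (eM v) (eM h) ↔ AckMem (eN v) (eN h)) {b a : N} {c : M}
    (hPsi : ∀ u, PsiD Set.univ (eM u) c → PsiD (below b) (eN u) a) :
    ∃ j : M ↪[LA] N, IsProperInitial j ∧ j c = a ∧ (∀ m : M, j m < b) ∧
      ∀ i : I, j (eM i) = eN i := by
  obtain ⟨L, hL, hL0, hmono, htot, hback⟩ := exists_back_and_forth (PartialTransfer eM eN b)
    (· < ·) [(c, a)] (by
      refine ⟨_, _, codesList_nil.append c, codesList_nil.append a, fun u hu => ?_⟩
      simp only [List.length_nil, Nat.cast_zero, zero_add] at hu ⊢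
      obtain ⟨p, -, hp, h⟩ := hPsi u ⟨_, trivial, expD_univ.2 (exp_pow2 _), hu⟩
      rwa [← exp_iff.1 hp.exp])
    (by
      rintro l ⟨c, a, hc, ha, hP⟩ m
      obtain ⟨x, hx⟩ := hP.forth hM hN hS.le hE (numeral I l.length) m
      rw [emb_numeral, emb_numeral] at hx
      have hc' := hc.append m
      have ha' := ha.append x
      rw [List.length_map] at hc' ha'
      exact ⟨x, _, _, by simpa using hc', by simpa using ha', hx⟩)
    (by
      rintro l ⟨c, a, hc, ha, hP⟩ p hp x' hx'
      obtain ⟨k, hk⟩ := List.mem_iff_getElem?.1 hp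
      obtain ⟨x, hx⟩ := hP.back hM hN hS.ge hE (numeral I l.length) (numeral I k) (y := p.1)
        (y' := p.2) (by
          rw [emb_numeral, hc.ackMem_pair, List.getElem?_map, hk]
          rfl) (fun z hz => by
          rw [emb_numeral, ha.ackMem_pair, List.getElem?_map, hk] at hz
          exact (Option.some_inj.1 hz).symm) hx'
      rw [emb_numeral, emb_numeral] at hx
      have hc' := hc.append x
      have ha' := ha.append x'
      rw [List.length_map] at hc' ha'
      exact ⟨x, _, _, by simpa using hc', by simpa using ha', hx⟩)
  let G : M → N → Prop := fun m a => ∃ n, (m, a) ∈ L n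
  -- Single-valuedness, preservation of `0`, sums and products, the values on the cut and the bound
  -- `b` are all instances of this one atomic shape.
  have atom : ∀ {x y z w : M} {x' y' z' w' : N}, G x x' → G y y' → G z z' → G w w' →
      ∀ i : I, x * y + z = w + eM i → x' * y' + z' = w' + eN i ∧ x' < b := by
    rintro x y z w x' y' z' w' ⟨n₁, h₁⟩ ⟨n₂, h₂⟩ ⟨n₃, h₃⟩ ⟨n₄, h₄⟩ i h
    have le₁ : n₁ ≤ n₁ + n₂ + n₃ + n₄ := by omega
    have le₂ : n₂ ≤ n₁ + n₂ + n₃ + n₄ := by omega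
    have le₃ : n₃ ≤ n₁ + n₂ + n₃ + n₄ := by omega
    have le₄ : n₄ ≤ n₁ + n₂ + n₃ + n₄ := by omega
    exact (hL _).atom (hmono _ _ le₁ h₁) (hmono _ _ le₂ h₂) (hmono _ _ le₃ h₃)
      (hmono _ _ le₄ h₄) h
  choose j hj using fun m => (exists_comm.1 (htot m) : ∃ a, G m a)
  have e0 : eM 0 = 0 := emb_zero eM
  have e0' : eN 0 = 0 := emb_zero eN
  have G0 : ∀ {x}, G 0 x → x = 0 := by
    intro x hx
    have := (atom hx hx hx hx 0 (by rw [e0]; ring)).1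
    rw [e0', add_zero, add_eq_right] at this
    exact mul_self_eq_zero.1 this
  have j0 : j 0 = 0 := G0 (hj 0)
  have gadd : ∀ {z w : M} {z' w' : N}, G z z' → G w w' → ∀ i, z = w + eM i →
      z' = w' + eN i := by
    intro z w z' w' hz hw i h
    have := (atom (hj 0) (hj 0) hz hw i (by rw [h]; ring)).1
    rwa [j0, zero_mul, zero_add] at this
  have gfun : ∀ {m a}, G m a → j m = a := by
    intro m a h
    have := gadd (hj m) h 0 (by rw [e0, add_zero])
    rwa [e0', add_zero] at this
  have jI : ∀ i, j (eM i) = eN i := by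
    intro i
    have := gadd (hj (eM i)) (hj 0) i (by rw [zero_add])
    rwa [j0, zero_add] at this
  have jone : j 1 = 1 := by
    have := jI (one I)
    rwa [emb_one, emb_one, one_eq, one_eq] at this
  have jmul : ∀ x y, j (x * y) = j x * j y := by
    intro x y
    have := (atom (hj x) (hj y) (hj 0) (hj (x * y)) 0 (by rw [e0])).1
    rw [j0, e0', add_zero, add_zero] at this
    exact this.symm
  have jadd : ∀ x y, j (x + y) = j x + j y := by
    intro x y
    have := (atom (hj x) (hj 1) (hj y) (hj (x + y)) 0 (by rw [e0]; ring)).1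
    rw [jone, e0', mul_one, add_zero] at this
    exact this.symm
  have jb : ∀ m, j m < b := by
    intro m
    exact (atom (hj m) (hj 0) (hj 0) (hj 0) 0 (by rw [e0]; ring)).2
  -- No atom mentions the order; it is recovered from addition, since `x < y` means `y = x + 1 + z`.
  have jmono : StrictMono j := by
    intro x y h
    obtain ⟨z, rfl⟩ := exists_add_of_le (add_one_le_iff'.2 h)
    rw [jadd, jadd, jone]
    exact (lt_add_one _).trans_le le_self_add
  let J : M ↪[LA] N :=
    { toFun := j
      inj' := jmono.injective
      map_fun' := by
        intro n f v
        cases f with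
        | zero => exact j0
        | succ =>
          show j (ArithStructure.succ (v 0)) = ArithStructure.succ (j (v 0))
          rw [succ_eq, succ_eq, jadd, jone]
        | add => exact jadd _ _
        | mul => exact jmul _ _
      map_rel' := by
        intro n r v
        cases r with
        | lt => exact jmono.lt_iff_lt }
  refine ⟨J, ⟨?_, ?_⟩, gfun ⟨0, by rw [hL0]; simp⟩, jb, jI⟩
  · rintro _ ⟨m, rfl⟩ a ha
    obtain ⟨n, hn⟩ := hj m
    obtain ⟨n', m', h'⟩ := hback n _ hn a ha
    exact ⟨m', gfun ⟨n', h'⟩⟩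
  · intro hsurj
    obtain ⟨m, hm⟩ := hsurj b
    exact (jb m).ne hm

end Construction

/-! ### Preservation under initial embeddings -/

section Preservation

variable {M N : Type*} [ArithStructure M] [ArithStructure N] {j : M ↪[LA] N}

theorem realize_emb {α : Type*} {n : ℕ} (t : LA.Term (α ⊕ Fin n)) (v : α → M) (xs : Fin n → M) :
    t.realize (Sum.elim (j ∘ v) (j ∘ xs)) = j (t.realize (Sum.elim v xs)) := by
  rw [← Sum.comp_elim, Language.HomClass.realize_term]

theorem IsDelta0.realize_emb (hj : IsInitialSegment (Set.range j)) {α : Type*} {n : ℕ}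
    {φ : LA.BoundedFormula α n} (hφ : IsDelta0 φ) (v : α → M) : ∀ xs : Fin n → M,
    φ.Realize (j ∘ v) (j ∘ xs) ↔ φ.Realize v xs := by
  induction hφ with
  | falsum => exact fun _ => Iff.rfl
  | equal s t =>
    intro xs
    show s.realize _ = t.realize _ ↔ s.realize _ = t.realize _
    rw [ArithModel.realize_emb, ArithModel.realize_emb, j.injective.eq_iff]
  | lt s t =>
    intro xs
    rw [realize_ltFormula, realize_ltFormula, ArithModel.realize_emb, ArithModel.realize_emb,
      emb_lt]
  | imp _ _ hφ hψ =>
    intro xs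
    rw [Language.BoundedFormula.realize_imp, Language.BoundedFormula.realize_imp, hφ, hψ]
  | ball t _ hφ =>
    intro xs
    simp only [Language.BoundedFormula.realize_all, Language.BoundedFormula.realize_imp,
      realize_ltBound, ArithModel.realize_emb]
    constructor
    · intro h x hx
      rw [← hφ, Fin.comp_snoc]
      exact h (j x) ((emb_lt j).2 hx)
    · intro h y hy
      obtain ⟨x, rfl⟩ := hj _ ⟨_, rfl⟩ y hy
      rw [← Fin.comp_snoc, hφ]
      exact h x ((emb_lt j).1 hy)
  | bex t _ hφ =>
    intro xs
    simp only [Language.BoundedFormula.realize_ex, Language.BoundedFormula.realize_inf,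
      realize_ltBound, ArithModel.realize_emb]
    constructor
    · rintro ⟨y, hy, h⟩
      obtain ⟨x, rfl⟩ := hj _ ⟨_, rfl⟩ y hy
      rw [← Fin.comp_snoc, hφ] at h
      exact ⟨x, (emb_lt j).1 hy, h⟩
    · rintro ⟨x, hx, h⟩
      refine ⟨j x, (emb_lt j).2 hx, ?_⟩
      rwa [← Fin.comp_snoc, hφ]

theorem IsSigma1.realize_emb (hj : IsInitialSegment (Set.range j)) {α : Type*} {n : ℕ}
    {φ : LA.BoundedFormula α n} (hφ : IsSigma1 φ) (v : α → M) : ∀ xs : Fin n → M,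
    φ.Realize v xs → φ.Realize (j ∘ v) (j ∘ xs) := by
  induction hφ with
  | of_delta0 h => exact fun xs => (h.realize_emb hj v xs).2
  | ex _ ih =>
    intro xs
    simp only [Language.BoundedFormula.realize_ex]
    rintro ⟨x, hx⟩
    refine ⟨j x, ?_⟩
    rw [← Fin.comp_snoc]
    exact ih _ hx

theorem Beta.emb {s t i v : M} (h : Beta s t i v) : Beta (j s) (j t) (j i) (j v) := by
  obtain ⟨hv, q, hq⟩ := h
  refine ⟨?_, j q, ?_⟩
  · rw [← emb_one j, ← emb_add, ← emb_mul, ← emb_add, emb_lt]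
    exact hv
  · rw [← emb_one j, ← emb_add, ← emb_mul, ← emb_add, ← emb_mul, ← emb_add, hq]

theorem Exp.emb (hj : IsInitialSegment (Set.range j)) {x y : M} (h : Exp x y) :
    Exp (j x) (j y) := by
  obtain ⟨s, t, h0, hs, h⟩ := h
  refine ⟨j s, j t, ?_, fun i hi => ?_, h.emb⟩
  · rw [← emb_zero j, ← emb_one j]
    exact h0.emb
  · obtain ⟨i, rfl⟩ := hj _ ⟨x, rfl⟩ i hi
    obtain ⟨v, hv, hv'⟩ := hs i ((emb_lt j).1 hi)
    refine ⟨j v, hv.emb, ?_⟩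
    rw [← emb_one j, ← emb_add, ← emb_add]
    exact hv'.emb

theorem AckMem.emb (hj : IsInitialSegment (Set.range j)) {x y : M} (h : AckMem x y) :
    AckMem (j x) (j y) := by
  obtain ⟨p, hp, q, r, hr, rfl⟩ := h
  refine ⟨j p, hp.emb hj, j q, j r, (emb_lt j).2 hr, ?_⟩
  simp only [emb_add, emb_mul, emb_one]

theorem AckNMem.emb (hj : IsInitialSegment (Set.range j)) {x y : M} (h : AckNMem x y) :
    AckNMem (j x) (j y) := by
  obtain ⟨p, hp, q, r, hr, rfl⟩ := h
  refine ⟨j p, hp.emb hj, j q, j r, (emb_lt j).2 hr, ?_⟩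
  simp only [emb_add, emb_mul]

variable [Fact (ModelsISigma1 M)] [Fact (ModelsISigma1 N)]

/-- Σ₁-facts only go up along an initial embedding; the converse comes from the Σ₁ form of
non-membership. -/
theorem ackMem_emb (hj : IsInitialSegment (Set.range j)) {x y : M} :
    AckMem (j x) (j y) ↔ AckMem x y := by
  refine ⟨fun h => ?_, fun h => h.emb hj⟩
  by_contra h'
  exact ackNMem_iff.1 ((ackNMem_iff.2 h').emb hj) h

/-- For `d` in `N`, only the digits below `j n` matter, with `n` above the cut. The remainder of `d`
modulo `2 ^ j n` is less than `j (pow2 n)`, hence lies in the range of `j`. -/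
theorem ssy_eq {I : Type*} [ArithStructure I] {eM : I ↪[LA] M} {eN : I ↪[LA] N}
    (hM : IsProperExpCut eM) (hj : IsInitialSegment (Set.range j))
    (hjI : ∀ i, j (eM i) = eN i) : SSy eM = SSy eN := by
  apply Set.Subset.antisymm
  · rintro _ ⟨c, rfl⟩
    refine ⟨j c, ?_⟩
    simp only [← hjI, ackMem_emb hj]
  · rintro _ ⟨d, rfl⟩
    obtain ⟨n, hn⟩ := hM.exists_notMem
    obtain ⟨r, hr, hr'⟩ := exists_mod_pow2 d (j n)
    rw [← exp_iff.1 ((exp_pow2 n).emb hj)] at hr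
    obtain ⟨c, rfl⟩ := hj _ ⟨_, rfl⟩ r hr
    refine ⟨c, ?_⟩
    ext i
    have := hr' (j (eM i))
    rw [ackMem_emb hj, hjI, and_iff_right] at this
    · exact this.symm
    · rw [← hjI, emb_lt]
      exact hM.lt hn i

end Preservation

/-! ### Transfer of formulas -/

/-- The environment given by two elements. -/
def env₂ {K : Type*} [ArithStructure K] (x y : K) : ℕ → K := scons x (scons y fun _ => 0)

/-- A formula in two variables as a `Δ₀`-formula in these and a bound. -/
def Fm.toDelta0 (f : Fm Empty) : LA.Formula (Fin 3) :=
  f.tr (n := 0) (Language.Term.var (Sum.inl 2)) Empty.elim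
    (scons (Language.Term.var (Sum.inl 0)) (scons (Language.Term.var (Sum.inl 1))
      fun _ => zeroTerm))

theorem Fm.realize_toDelta0 {K : Type*} [ArithStructure K] (f : Fm Empty) (x y z : K) :
    f.toDelta0.Realize ![x, y, z] ↔ f.eval (below z) Empty.elim (env₂ x y) := by
  refine (Fm.realize_tr f _ _ _ _ _).trans (Eq.to_iff ?_)
  congr 1
  · funext c
    exact c.elim
  · funext k
    match k with
    | 0 => rfl
    | 1 => rfl
    | k + 2 => rfl

/-- The existential closure, in the bound, of a formula in one variable, as a sentence with a
constant. -/
def Fm.toSigma1 {I : Type*} (f : Fm Empty) (i : I) : LA.Formula I :=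
  Language.BoundedFormula.ex (f.tr (n := 1) lastVar Empty.elim
    (scons (Language.Term.var (Sum.inl i)) fun _ => zeroTerm))

theorem Fm.realize_toSigma1 {I K : Type*} [ArithStructure K] [Fact (ModelsISigma1 K)]
    (f : Fm Empty) (i : I) (e : I → K) :
    (f.toSigma1 i).Realize e ↔ f.eval Set.univ Empty.elim (env₂ (e i) 0) := by
  rw [Fm.eval_univ_iff]
  show Language.BoundedFormula.Realize _ _ _ ↔ _
  simp only [Fm.toSigma1, Language.BoundedFormula.realize_ex]
  refine exists_congr fun z => (Fm.realize_tr f _ _ _ _ _).trans (Eq.to_iff ?_)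
  rw [realize_lastVar]
  congr 1
  · funext c
    exact c.elim
  · funext k
    match k with
    | 0 => rfl
    | 1 => rfl
    | k + 2 => rfl

section Main

variable {I M N : Type*} [ArithStructure I] [ArithStructure M] [ArithStructure N]
  [Fact (ModelsISigma1 M)] [Fact (ModelsISigma1 N)] {eM : I ↪[LA] M} {eN : I ↪[LA] N}

/-- The agreement is not immediate from the shared structure on `I`, since the sequences witnessing
`Exp` may lie outside the cut. Two cut elements are packed into one by `pair`, as formulas carry a
single parameter from `I`. -/
theorem ackMem_iff_of_transfer {c : M} {a : N}
    (h : ∀ (f : Fm Empty) (i : I), f.eval Set.univ Empty.elim (env₂ (eM i) c) →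
      f.eval Set.univ Empty.elim (env₂ (eN i) a)) (v g : I) :
    AckMem (eM v) (eM g) ↔ AckMem (eN v) (eN g) := by
  have hmem : AckMem (eM v) (eM g) → AckMem (eN v) (eN g) := by
    intro H
    obtain ⟨x, -, y, -, hxy, hm⟩ := (Fm.eval_memPair _ _ _).1 (h Fm.memPair (pair v g)
      ((Fm.eval_memPair _ _ _).2 ⟨eM v, trivial, eM g, trivial, emb_pair eM v g,
        memD_univ.2 H⟩))
    obtain ⟨rfl, rfl⟩ := pair_inj.1 ((emb_pair eN v g).symm.trans hxy)
    exact hm.mem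
  have hnmem : AckNMem (eM v) (eM g) → AckNMem (eN v) (eN g) := by
    intro H
    obtain ⟨x, -, y, -, hxy, hm⟩ := (Fm.eval_nmemPair _ _ _).1 (h Fm.nmemPair (pair v g)
      ((Fm.eval_nmemPair _ _ _).2 ⟨eM v, trivial, eM g, trivial, emb_pair eM v g,
        nmemD_univ.2 H⟩))
    obtain ⟨rfl, rfl⟩ := pair_inj.1 ((emb_pair eN v g).symm.trans hxy)
    exact hm.nmem
  refine ⟨hmem, fun H => ?_⟩
  by_contra H'
  exact ackNMem_iff.1 (hnmem (ackNMem_iff.2 H')) H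

theorem exists_bounded_properInitial_iff [Countable M] [Countable N] (hM : IsProperExpCut eM)
    (hN : IsProperExpCut eN) (c : M) (a b : N) :
    (∃ j : M ↪[LA] N, IsProperInitial j ∧ j c = a ∧ (∀ m : M, j m < b) ∧
        ∀ i : I, j (eM i) = eN i) ↔
      (SSy eM = SSy eN ∧
        ∀ (i : I) (δ : LA.Formula (Fin 3)), IsDelta0 δ →
          (∃ z : M, δ.Realize ![eM i, c, z]) →
            ∃ z : N, z < b ∧ δ.Realize ![eN i, a, z]) := by
  constructor
  · rintro ⟨j, hj, rfl, hb, hjI⟩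
    refine ⟨ssy_eq hM hj.initial hjI, fun i δ hδ ⟨z, hz⟩ => ⟨j z, hb z, ?_⟩⟩
    have h := (hδ.realize_emb hj.initial ![eM i, c, z] default).2 hz
    have e₁ : j ∘ ![eM i, c, z] = ![eN i, j c, j z] := by
      funext k
      match k with
      | 0 => exact hjI i
      | 1 => rfl
      | 2 => rfl
    rw [e₁, Subsingleton.elim (j ∘ default) default] at h
    exact h
  · rintro ⟨hS, h⟩
    have hT : ∀ (f : Fm Empty) (i : I), f.eval Set.univ Empty.elim (env₂ (eM i) c) →
        f.eval (below b) Empty.elim (env₂ (eN i) a) := by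
      intro f i hf
      obtain ⟨z, hz⟩ := (Fm.eval_univ_iff _ _ _).1 hf
      obtain ⟨z', hz', h'⟩ := h i f.toDelta0 (Fm.isDelta0_tr _ _ _ _)
        ⟨z, (Fm.realize_toDelta0 _ _ _ _).2 hz⟩
      exact Fm.eval_mono (below_mono hz'.le) ((Fm.realize_toDelta0 _ _ _ _).1 h')
    exact exists_properInitial hM hN hS
      (ackMem_iff_of_transfer fun f i hf => Fm.eval_mono (Set.subset_univ _) (hT f i hf))
      fun u hu => (Fm.eval_psi _ _ _).1 (hT Fm.psi u ((Fm.eval_psi _ _ _).2 hu))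

/-- A common bound for the witnesses of the true `Σ₁`-statements with parameters below `n`. -/
theorem exists_psiD_bound (n x : N) :
    ∃ b, ∀ u < n, PsiD Set.univ u x → PsiD (below b) u x := by
  obtain ⟨h, hh⟩ := exists_code (fun u => PsiD Set.univ u x) n
  -- The first disjunct makes `f` true for every `u < n`, so that collection applies; it fails
  -- exactly for the true codes.
  let f : Fm N := .or (.nmem (.var 0) (.const h)) .psi
  have key : ∀ D u, f.eval D id (scons u fun _ => x) ↔ NMemD D u h ∨ PsiD D u x :=
    fun D u => Iff.rfl
  obtain ⟨b, hb⟩ := Fm.collection id f (fun _ => x) n fun u hu => by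
    rw [← Fm.eval_univ_iff, key, nmemD_univ, ackNMem_iff, hh]
    tauto
  refine ⟨b, fun u hu hu' => ((key _ _).1 (hb u hu)).resolve_left fun h' => ?_⟩
  exact ackNMem_iff.1 h'.nmem ((hh u).2 ⟨hu, hu'⟩)

theorem exists_properInitial_iff [Countable M] [Countable N] (hM : IsProperExpCut eM)
    (hN : IsProperExpCut eN) :
    (∃ j : M ↪[LA] N, IsProperInitial j ∧ ∀ i : I, j (eM i) = eN i) ↔
      (ThSigma1 eM ⊆ ThSigma1 eN ∧ SSy eM = SSy eN) := by
  constructor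
  · rintro ⟨j, hj, hjI⟩
    refine ⟨fun φ ⟨hφ, h⟩ => ⟨hφ, ?_⟩, ssy_eq hM hj.initial hjI⟩
    have h' := hφ.realize_emb hj.initial (eM : I → M) default h
    have e₁ : j ∘ (eM : I → M) = eN := funext hjI
    rw [e₁, Subsingleton.elim (j ∘ default) default] at h'
    exact h'
  · rintro ⟨hTh, hS⟩
    have hT : ∀ (f : Fm Empty) (i : I), f.eval Set.univ Empty.elim (env₂ (eM i) 0) →
        f.eval Set.univ Empty.elim (env₂ (eN i) 0) := by
      intro f i hf
      have hσ : IsSigma1 (f.toSigma1 i) := .ex (.of_delta0 (Fm.isDelta0_tr _ _ _ _))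
      exact (Fm.realize_toSigma1 f i eN).1 (hTh ⟨hσ, (Fm.realize_toSigma1 f i eM).2 hf⟩).2
    obtain ⟨n, hn⟩ := hN.exists_notMem
    -- All codes from the cut lie below `n`, so one `b` bounds all witnesses needed. No elements
    -- `c`, `a` are prescribed, and `0` is used for both.
    obtain ⟨b, hb⟩ := exists_psiD_bound n (0 : N)
    obtain ⟨j, hj, -, -, hjI⟩ := exists_properInitial hM hN hS (ackMem_iff_of_transfer hT)
      (b := b) (a := 0) (c := 0) fun u hu =>
        hb _ (hN.lt hn u) ((Fm.eval_psi _ _ _).1 (hT Fm.psi u ((Fm.eval_psi _ _ _).2 hu)))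
    exact ⟨j, hj, hjI⟩

end Main

end ArithModel

open ArithModel
theorem theorem3p3 {M N I : Type*} [ArithStructure M] [ArithStructure N] [ArithStructure I]
    [Countable M] [Countable N]
    (hM : ModelsISigma1 M) (hN : ModelsISigma1 N)
    (hMns : IsNonstandard M) (hNns : IsNonstandard N)
    (eM : I ↪[LA] M) (eN : I ↪[LA] N)
    (hIM : IsProperExpCut eM) (hIN : IsProperExpCut eN) :
    (∀ (c : M) (a b : N),
      (∃ j : M ↪[LA] N, IsProperInitial j ∧ j c = a ∧ (∀ m : M, j m < b) ∧
          ∀ i : I, j (eM i) = eN i) ↔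
        (SSy eM = SSy eN ∧
          ∀ (i : I) (δ : LA.Formula (Fin 3)), IsDelta0 δ →
            (∃ z : M, δ.Realize ![eM i, c, z]) →
              ∃ z : N, z < b ∧ δ.Realize ![eN i, a, z])) ∧
    ((∃ j : M ↪[LA] N, IsProperInitial j ∧ ∀ i : I, j (eM i) = eN i) ↔
      (ThSigma1 eM ⊆ ThSigma1 eN ∧ SSy eM = SSy eN)) := by
  have : Fact (ModelsISigma1 M) := ⟨hM⟩
  have : Fact (ModelsISigma1 N) := ⟨hN⟩
  exact ⟨exists_bounded_properInitial_iff hIM hIN, exists_properInitial_iff hIM hIN⟩
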